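/- All Hilbert spaces are finite-dimensional and nonzero, with fixed orthonormal bases, and logarithms are to base two. Let $\mathcal N_{A'\to B}$ be a quantum channel (a completely positive trace-preserving linear map) and let $\varepsilon\in(0,1)$. A no-signalling-assisted code of size $m$ for a channel $\mathcal M_{C\to D}$ is a bipartite quantum channel $\Pi_{A_0D\to CB_0}$ with $\dim A_0=\dim B_0=m$ that is no-signalling in both directions: $\mathrm{tr}_{B_0}\Pi(X)$ depends only on $\mathrm{tr}_{D}X$, and $\mathrm{tr}_{C}\Pi(X)$ depends only on $\mathrm{tr}_{A_0}X$. Connecting the output $C$ of $\Pi$ to the input of $\mathcal M$ and the output of $\mathcal M$ to the input $D$ of $\Pi$ gives the effective map $\Pi\circ\mathcal M$ from $A_0$ to $B_0$, namely $$(\Pi\circ\mathcal M)(X)=\sum_{p,q}(\langle p|_D\otimes 1_{B_0})\,(\mathcal M\otimes\mathrm{id}_{B_0})\big(\Pi(X\otimes|p\rangle\langle q|_D)\big)\,(|q\rangle_D\otimes 1_{B_0}).$$ Let $$p_{\mathrm{succ}}(\mathcal M,m)=\sup_{\Pi}\frac1m\sum_{k=1}^m\mathrm{tr}\big[(\Pi\circ\mathcal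 M)(|k\rangle\langle k|)\,|k\rangle\langle k|\big]$$ over all such codes, and let $$C_{\mathrm{NS}}^{(1)}(\mathcal M,\varepsilon)=\sup\{\log m : m\in\mathbb N,\ m\ge1,\ p_{\mathrm{succ}}(\mathcal M,m)\ge1-\varepsilon\}.$$ The activated capacity is $$C_{\mathrm{NS},a}^{(1)}(\mathcal N,\varepsilon)=\sup_{m\ge1}\big[C_{\mathrm{NS}}^{(1)}(\mathcal N\otimes\mathcal I_m,\varepsilon)-\log m\big],\qquad \mathcal I_m(\rho)=\sum_{i=1}^m\mathrm{tr}(\rho|i\rangle\langle i|)\,|i\rangle\langle i| .$$ For states $\rho_0,\rho_1$ let $D_H^\varepsilon(\rho_0\|\rho_1)=-\log\min\{\mathrm{tr}\,Q\rho_1 : 0\le Q\le 1,\ 1-\mathrm{tr}\,Q\rho_0\le\varepsilon\}$, with $-\log 0=+\infty$. For a state $\rho$ of $A'$ and a copy $A$ of $A'$ let $\phi^\rho_{AA'}=(1_A\otimes\sqrt\rho)\big(\sum_{i,j}|ii\rangle\langle jj|\big)(1_A\otimes\sqrt\rho)$ be its canonical purification, with reduced state $\phi^\rho_A$ on $A$.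 The Matthews–Wehner meta-converse is $$R(\mathcal N,\varepsilon)=\max_{\rho}\min_{\sigma_B}D_H^\varepsilon\big((\mathrm{id}_A\otimes\mathcal N)(\phi^\rho_{AA'})\,\big\|\,\phi^\rho_A\otimes\sigma_B\big),$$ over all states $\rho$ of $A'$ and $\sigma_B$ of $B$. **Theorem.** The maximum over $\rho$ and, for every $\rho$, the minimum over $\sigma_B$ are attained, and $$C_{\mathrm{NS},a}^{(1)}(\mathcal N,\varepsilon)=R(\mathcal N,\varepsilon).$$ -/

import Mathlib

open scoped Kronecker MatrixOrder ComplexOrder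

noncomputable section

namespace QuantumChannelCoding

/-! Operators on the Hilbert space `ℂ^a` (`a` a finite index set) are the matrices
`Matrix a a ℂ`, and operators on the tensor product of `ℂ^a` and `ℂ^b` are the matrices
indexed by `a × b`. -/

/-- Density operators: positive semidefinite operators of trace one. -/
def IsState {a : Type*} [Fintype a] (ρ : Matrix a a ℂ) : Prop :=
  ρ.PosSemidef ∧ ρ.trace = 1

/-- The partial trace over the first tensor factor. -/
def traceLeft {a b : Type*} [Fintype a] (X : Matrix (a × b) (a × b) ℂ) : Matrix b b ℂ :=
  Matrix.of fun p q => ∑ i, X (i, p) (i, q)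

/-- The partial trace over the second tensor factor. -/
def traceRight {a b : Type*} [Fintype b] (X : Matrix (a × b) (a × b) ℂ) : Matrix a a ℂ :=
  Matrix.of fun i j => ∑ p, X (i, p) (j, p)

/-- The map `id_κ ⊗ Φ`: apply `Φ` to the second tensor factor. -/
def idTensor {a b : Type*} (κ : Type*) (Φ : Matrix a a ℂ →ₗ[ℂ] Matrix b b ℂ) :
    Matrix (κ × a) (κ × a) ℂ →ₗ[ℂ] Matrix (κ × b) (κ × b) ℂ where
  toFun X := Matrix.of fun r s => Φ (Matrix.of fun u v => X (r.1, u) (s.1, v)) r.2 s.2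
  map_add' X Y := by
    ext r s
    exact congrFun (congrFun (Φ.map_add (Matrix.of fun u v => X (r.1, u) (s.1, v))
      (Matrix.of fun u v => Y (r.1, u) (s.1, v))) r.2) s.2
  map_smul' c X := by
    ext r s
    exact congrFun (congrFun (Φ.map_smul c (Matrix.of fun u v => X (r.1, u) (s.1, v))) r.2) s.2

/-- The map `Φ ⊗ id_κ`: apply `Φ` to the first tensor factor. -/
def tensorId {a b : Type*} (Φ : Matrix a a ℂ →ₗ[ℂ] Matrix b b ℂ) (κ : Type*) :
    Matrix (a × κ) (a × κ) ℂ →ₗ[ℂ] Matrix (b × κ) (b × κ) ℂ where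
  toFun X := Matrix.of fun r s => Φ (Matrix.of fun u v => X (u, r.2) (v, s.2)) r.1 s.1
  map_add' X Y := by
    ext r s
    exact congrFun (congrFun (Φ.map_add (Matrix.of fun u v => X (u, r.2) (v, s.2))
      (Matrix.of fun u v => Y (u, r.2) (v, s.2))) r.1) s.1
  map_smul' c X := by
    ext r s
    exact congrFun (congrFun (Φ.map_smul c (Matrix.of fun u v => X (u, r.2) (v, s.2))) r.1) s.1

/-- The tensor product `Φ ⊗ Ψ` of two linear maps between operator spaces. -/
def tensorMap {a b c d : Type*} (Φ : Matrix a a ℂ →ₗ[ℂ] Matrix b b ℂ)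
    (Ψ : Matrix c c ℂ →ₗ[ℂ] Matrix d d ℂ) :
    Matrix (a × c) (a × c) ℂ →ₗ[ℂ] Matrix (b × d) (b × d) ℂ :=
  (idTensor b Ψ).comp (tensorId Φ c)

/-- Complete positivity: `id_k ⊗ Φ` preserves positive semidefiniteness for every `k`. -/
def IsCompletelyPositive {a b : Type*} (Φ : Matrix a a ℂ →ₗ[ℂ] Matrix b b ℂ) : Prop :=
  ∀ (k : ℕ) (X : Matrix (Fin k × a) (Fin k × a) ℂ),
    X.PosSemidef → (idTensor (Fin k) Φ X).PosSemidef

/-- Quantum channels: completely positive trace-preserving linear maps. -/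
structure IsChannel {a b : Type*} [Fintype a] [Fintype b]
    (Φ : Matrix a a ℂ →ₗ[ℂ] Matrix b b ℂ) : Prop where
  completelyPositive : IsCompletelyPositive Φ
  trace_preserving : ∀ X, (Φ X).trace = X.trace

/-- The noiseless classical channel `ρ ↦ ∑ i, tr (ρ |i⟩⟨i|) |i⟩⟨i|` on `m` symbols. -/
def classicalId (m : ℕ) : Matrix (Fin m) (Fin m) ℂ →ₗ[ℂ] Matrix (Fin m) (Fin m) ℂ where
  toFun ρ := ∑ i, (ρ * Matrix.single i i 1).trace • Matrix.single i i (1 : ℂ)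
  map_add' X Y := by
    simp only [add_mul, Matrix.trace_add, add_smul, Finset.sum_add_distrib]
  map_smul' c X := by
    simp only [Matrix.smul_mul, Matrix.trace_smul, smul_assoc, Finset.smul_sum, RingHom.id_apply]

/-! ### Codes assisted by no-signalling correlations

A code of size `m` for channels from `ℂ^a` to `ℂ^b` is a bipartite map with inputs
`A` (Alice's message, dimension `m`) and `B` (Bob's input, the output of the channel) and
outputs `A'` (Alice's output, the input of the channel) and `B'` (Bob's estimate of the
message, dimension `m`). -/

/-- A no-signalling-assisted code: a bipartite channel `Π_{AB → A'B'}` such that Alice's reduced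
output depends only on Alice's reduced input, and Bob's only on Bob's. -/
structure IsNSCode {a b : Type*} [Fintype a] [Fintype b] {m : ℕ}
    (P : Matrix (Fin m × b) (Fin m × b) ℂ →ₗ[ℂ] Matrix (a × Fin m) (a × Fin m) ℂ) : Prop where
  isChannel : IsChannel P
  noSignal_bob_to_alice : ∀ X Y, traceRight X = traceRight Y →
    traceRight (P X) = traceRight (P Y)
  noSignal_alice_to_bob : ∀ X Y, traceLeft X = traceLeft Y →
    traceLeft (P X) = traceLeft (P Y)

/-- The effective map `M_{A → B'} = Π ∘ N`: the output `A'` of the code is sent through `N`, and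
the output of `N` is wired to the input `B` of the code, that is,
`M(X) = ∑ p q, (⟨p| ⊗ 1) (N ⊗ id) (Π (X ⊗ |p⟩⟨q|)) (|q⟩ ⊗ 1)`.
For a product code `Π = E ⊗ D` this is `D ∘ N ∘ E`. -/
def effective {a b : Type*} [Fintype b] [DecidableEq b] {m : ℕ}
    (P : Matrix (Fin m × b) (Fin m × b) ℂ →ₗ[ℂ] Matrix (a × Fin m) (a × Fin m) ℂ)
    (N : Matrix a a ℂ →ₗ[ℂ] Matrix b b ℂ) (X : Matrix (Fin m) (Fin m) ℂ) :
    Matrix (Fin m) (Fin m) ℂ :=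
  ∑ p, ∑ q, (tensorId N (Fin m) (P (X ⊗ₖ Matrix.single p q 1))).submatrix
    (fun i => (p, i)) (fun j => (q, j))

/-- The average success probability `(1/m) ∑ k, tr M(|k⟩⟨k|) |k⟩⟨k|` of a code. -/
def successProb {a b : Type*} [Fintype b] [DecidableEq b] {m : ℕ}
    (P : Matrix (Fin m × b) (Fin m × b) ℂ →ₗ[ℂ] Matrix (a × Fin m) (a × Fin m) ℂ)
    (N : Matrix a a ℂ →ₗ[ℂ] Matrix b b ℂ) : ℝ :=
  (1 / (m : ℝ)) * ∑ k : Fin m,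
    (effective P N (Matrix.single k k 1) * Matrix.single k k 1).trace.re

/-- The optimal average success probability of sending `m` messages through `N` with
no-signalling-assisted codes. -/
def optSuccessNS {a b : Type*} [Fintype a] [Fintype b] [DecidableEq b]
    (N : Matrix a a ℂ →ₗ[ℂ] Matrix b b ℂ) (m : ℕ) : ℝ :=
  sSup {s : ℝ | ∃ P : Matrix (Fin m × b) (Fin m × b) ℂ →ₗ[ℂ] Matrix (a × Fin m) (a × Fin m) ℂ,
    IsNSCode P ∧ s = successProb P N}

/-- The one-shot `ε`-error capacity with no-signalling-assisted codes, in bits. -/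
def capacityNS {a b : Type*} [Fintype a] [Fintype b] [DecidableEq b]
    (N : Matrix a a ℂ →ₗ[ℂ] Matrix b b ℂ) (ε : ℝ) : EReal :=
  ⨆ (m : ℕ) (_ : 1 ≤ m) (_ : 1 - ε ≤ optSuccessNS N m), ((Real.logb 2 m : ℝ) : EReal)

/-- The one-shot `ε`-error capacity with activated no-signalling-assisted codes, in bits. -/
def activatedCapacityNS {a b : Type*} [Fintype a] [Fintype b] [DecidableEq b]
    (N : Matrix a a ℂ →ₗ[ℂ] Matrix b b ℂ) (ε : ℝ) : EReal :=
  ⨆ (m : ℕ) (_ : 1 ≤ m),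
    (capacityNS (tensorMap N (classicalId m)) ε - ((Real.logb 2 m : ℝ) : EReal))

/-! ### The hypothesis testing meta-converse -/

/-- The least type-II error of a test `0 ≤ Q ≤ 1` with type-I error at most `ε`. -/
def typeIIError {c : Type*} [Fintype c] [DecidableEq c] (ε : ℝ) (ρ₀ ρ₁ : Matrix c c ℂ) : ℝ :=
  sInf {t : ℝ | ∃ Q : Matrix c c ℂ, Q.PosSemidef ∧ (1 - Q).PosSemidef ∧
    1 - (Q * ρ₀).trace.re ≤ ε ∧ t = (Q * ρ₁).trace.re}

/-- The hypothesis testing relative entropy `-log₂ β_ε`, equal to `+∞` where `β_ε` vanishes. -/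
def hypTestEntropy {c : Type*} [Fintype c] [DecidableEq c] (ε : ℝ) (ρ₀ ρ₁ : Matrix c c ℂ) :
    EReal :=
  if typeIIError ε ρ₀ ρ₁ = 0 then ⊤ else ((-Real.logb 2 (typeIIError ε ρ₀ ρ₁) : ℝ) : EReal)

/-- The unnormalized maximally entangled operator `∑ i j, |i i⟩⟨j j|` on `AA'`. -/
def maxEntangled (a : Type*) [Fintype a] [DecidableEq a] : Matrix (a × a) (a × a) ℂ :=
  ∑ i, ∑ j, Matrix.single (i, i) (j, j) 1

/-- The canonical purification `(1_A ⊗ √ρ) Φ̃ (1_A ⊗ √ρ)` on `AA'` of a state `ρ` of `A'`. -/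
def purification {a : Type*} [Fintype a] [DecidableEq a] (ρ : Matrix a a ℂ) :
    Matrix (a × a) (a × a) ℂ :=
  ((1 : Matrix a a ℂ) ⊗ₖ CFC.sqrt ρ) * maxEntangled a * ((1 : Matrix a a ℂ) ⊗ₖ CFC.sqrt ρ)

/-- `D_H^ε (N_{A' → B}(φ_{AA'}) ‖ φ_A ⊗ σ_B)` for the canonical purification `φ` of `ρ`, where
`φ_A` is the reduced state of `φ` on the reference system `A`. -/
def metaObjective {a b : Type*} [Fintype a] [DecidableEq a] [Fintype b] [DecidableEq b]
    (N : Matrix a a ℂ →ₗ[ℂ] Matrix b b ℂ) (ε : ℝ) (ρ : Matrix a a ℂ) (σ : Matrix b b ℂ) : EReal :=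
  hypTestEntropy ε (idTensor a N (purification ρ)) (traceRight (purification ρ) ⊗ₖ σ)

/-- The inner optimum of the meta-converse, over the states `σ` of `B`. -/
def metaInner {a b : Type*} [Fintype a] [DecidableEq a] [Fintype b] [DecidableEq b]
    (N : Matrix a a ℂ →ₗ[ℂ] Matrix b b ℂ) (ε : ℝ) (ρ : Matrix a a ℂ) : EReal :=
  ⨅ (σ : Matrix b b ℂ) (_ : IsState σ), metaObjective N ε ρ σ

/-- The Matthews–Wehner meta-converse `R(N, ε)`. -/
def metaConverse {a b : Type*} [Fintype a] [DecidableEq a] [Fintype b] [DecidableEq b]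
    (N : Matrix a a ℂ →ₗ[ℂ] Matrix b b ℂ) (ε : ℝ) : EReal :=
  ⨆ (ρ : Matrix a a ℂ) (_ : IsState ρ), metaInner N ε ρ

end QuantumChannelCoding

end

/-!
Both sides are evaluated as `-log₂ η`, where `η` is the least number for which there are a state
`τ` and an operator `0 ≤ F ≤ τ ⊗ 1` with `tr (F J) ≥ 1 - ε` and `tr_A F ≤ η`; here `J` is the Choi
operator of the channel (`IsAchievableOverlap`, `exists_least_isAchievableOverlap`).

For the meta-converse, conjugating a test `Q` by the square root of the reference state gives
`F = (√ρᵀ ⊗ 1) Q (√ρᵀ ⊗ 1)`, and all `0 ≤ F ≤ ρᵀ ⊗ 1` arise in this way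
(`exists_effect_conj_eq`). The type-I condition becomes `tr (F J) ≥ 1 - ε` and the type-II error
against `σ` becomes `tr ((tr_A F) σ)` (`typeIIError_eq_sInf_testSet`), which is bilinear in `F` and
`σ`. Sion's minimax theorem provides a saddle point, hence the attained minimum over `σ` and a
single test `F` with `tr_A F` at most the saddle value (`exists_metaInner_eq`). Compactness of the
set of pairs `(τ, F)` gives the attained maximum over `ρ` (`exists_metaInner_eq_metaConverse`).

For the capacity, the success probability of a code of size `M` depends only on the average `F`
of the blocks of its Choi operator with correct estimate, up to a transpose. No signalling says
exactly that `F ≤ τ ⊗ 1` for some state `τ` and that `tr_A F = 1 / M`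
(`IsNSCode.exists_dominatedPair`, `exists_isNSCode`). The classical side channel with `m` symbols
relaxes the equality to `tr_A F ≤ m / M`: in one direction the blocks with faithfully transmitted
symbol are summed (`exists_dominatedPair_of_tensor`), in the other the slack is put on the
unfaithful ones (`exists_tensor_dominatedPair`). Since every ratio `m / M ≥ η` with `m, M ≥ 2` is
then realized by a code, the activated capacity is `-log₂ η` (`activatedCapacityNS_eq`).
-/

noncomputable section

namespace QuantumChannelCoding

/-! ### Positive semidefinite matrices and states -/

section PosSemidef

variable {n : Type*} [Fintype n]

lemma trace_mul_nonneg {A B : Matrix n n ℂ} (hA : A.PosSemidef) (hB : B.PosSemidef) :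
    0 ≤ (A * B).trace := by
  classical
  obtain ⟨C, hC⟩ := CStarAlgebra.nonneg_iff_eq_star_mul_self.mp hA.nonneg
  rw [hC, Matrix.star_eq_conjTranspose, Matrix.trace_mul_cycle, Matrix.trace_mul_cycle]
  exact (hB.mul_mul_conjTranspose_same C).trace_nonneg

lemma re_trace_mul_nonneg {A B : Matrix n n ℂ} (hA : A.PosSemidef) (hB : B.PosSemidef) :
    0 ≤ (A * B).trace.re :=
  (Complex.nonneg_iff.mp (trace_mul_nonneg hA hB)).1

lemma re_trace_nonneg {A : Matrix n n ℂ} (hA : A.PosSemidef) : 0 ≤ A.trace.re :=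
  (Complex.nonneg_iff.mp hA.trace_nonneg).1

omit [Fintype n] in
lemma posSemidef_real_smul {A : Matrix n n ℂ} (hA : A.PosSemidef) {c : ℝ} (hc : 0 ≤ c) :
    (c • A).PosSemidef := hA.smul hc

/-- Every entry of a positive semidefinite matrix is bounded by its trace. -/
lemma norm_entry_le_re_trace {A : Matrix n n ℂ} (hA : A.PosSemidef) (i j : n) :
    ‖A i j‖ ≤ A.trace.re := by
  classical
  have hd : ∀ k, 0 ≤ (A k k).re ∧ (A k k).im = 0 := fun k => by
    have := Complex.nonneg_iff.mp (hA.diag_nonneg (i := k)); exact ⟨this.1, this.2.symm⟩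
  have hle : ∀ k, (A k k).re ≤ A.trace.re := fun k => by
    rw [Matrix.trace, Complex.re_sum]
    exact Finset.single_le_sum (f := fun k => (A.diag k).re) (fun k _ => (hd k).1)
      (Finset.mem_univ k)
  have hdet := (hA.submatrix ![i, j]).det_nonneg
  have hji : A j i = star (A i j) := (hA.isHermitian.apply j i).symm
  simp only [Matrix.det_fin_two, Matrix.submatrix_apply, Matrix.cons_val_zero,
    Matrix.cons_val_one] at hdet
  rw [hji, Complex.star_def, Complex.mul_conj] at hdet
  have h := (Complex.nonneg_iff.mp hdet).1
  simp only [Complex.sub_re, Complex.mul_re, Complex.ofReal_re, (hd _).2, mul_zero, sub_zero,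
    Complex.normSq_eq_norm_sq] at h
  have h2 := mul_le_mul (hle i) (hle j) (hd j).1 ((hd i).1.trans (hle i))
  exact abs_le_of_sq_le_sq' (by nlinarith) ((hd i).1.trans (hle i)) |>.2

lemma isClosed_posSemidef : IsClosed {A : Matrix n n ℂ | A.PosSemidef} := by
  have : {A : Matrix n n ℂ | A.PosSemidef} =
      {A | A.conjTranspose = A} ∩ ⋂ x : n → ℂ, {A | 0 ≤ star x ⬝ᵥ (A.mulVec x)} := by
    ext A
    simp [Matrix.posSemidef_iff_dotProduct_mulVec, Matrix.IsHermitian]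
  rw [this]
  refine (isClosed_eq (by fun_prop) (by fun_prop)).inter (isClosed_iInter fun x => ?_)
  exact isClosed_le (by fun_prop) (by fun_prop)

lemma isCompact_of_posSemidef_of_trace_le {s : Set (Matrix n n ℂ)} (hs : IsClosed s) (c : ℝ)
    (h : ∀ A ∈ s, A.PosSemidef ∧ A.trace.re ≤ c) : IsCompact s := by
  have hc : IsCompact (Set.univ.pi fun _ : n => Set.univ.pi fun _ : n =>
      Metric.closedBall (0 : ℂ) c) :=
    isCompact_univ_pi fun _ => isCompact_univ_pi fun _ => isCompact_closedBall _ _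
  refine IsCompact.of_isClosed_subset hc hs fun A hA i _ j _ => ?_
  rw [mem_closedBall_zero_iff]
  exact (norm_entry_le_re_trace (h A hA).1 i j).trans (h A hA).2

lemma isClosed_isState : IsClosed {ρ : Matrix n n ℂ | IsState ρ} :=
  isClosed_posSemidef.inter (isClosed_eq (by fun_prop) (by fun_prop))

lemma isCompact_isState : IsCompact {ρ : Matrix n n ℂ | IsState ρ} :=
  isCompact_of_posSemidef_of_trace_le isClosed_isState 1
    fun ρ h => ⟨h.1, by rw [h.2]; simp⟩

omit [Fintype n] in
lemma convex_posSemidef : Convex ℝ {A : Matrix n n ℂ | A.PosSemidef} :=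
  fun _ hA _ hB _ _ hs ht _ => (posSemidef_real_smul hA hs).add (posSemidef_real_smul hB ht)

lemma convex_isState : Convex ℝ {ρ : Matrix n n ℂ | IsState ρ} :=
  fun _ hA _ hB s t hs ht hst => ⟨convex_posSemidef hA.1 hB.1 hs ht hst, by
    rw [Matrix.trace_add, Matrix.trace_smul, Matrix.trace_smul, hA.2, hB.2]
    simp [← Complex.ofReal_add, hst]⟩

variable [DecidableEq n]

lemma exists_isState [Nonempty n] : ∃ ρ : Matrix n n ℂ, IsState ρ := by
  obtain ⟨i⟩ := ‹Nonempty n›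
  refine ⟨Matrix.diagonal (Pi.single i 1), Matrix.PosSemidef.diagonal ?_, ?_⟩
  · intro j
    by_cases h : j = i
    · subst h; simp
    · simp [h]
  · simp [Matrix.trace]

/-- Pairing with states detects the operator order. -/
lemma posSemidef_smul_one_sub {G : Matrix n n ℂ} (hG : G.IsHermitian) {t : ℝ}
    (h : ∀ σ, IsState σ → (G * σ).trace.re ≤ t) : (t • (1 : Matrix n n ℂ) - G).PosSemidef := by
  have hH : (t • (1 : Matrix n n ℂ) - G).IsHermitian := by
    refine Matrix.IsHermitian.sub ?_ hG
    simp [Matrix.IsHermitian, Matrix.conjTranspose_smul]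
  refine Matrix.PosSemidef.of_dotProduct_mulVec_nonneg hH fun x => ?_
  rw [Complex.nonneg_iff]
  refine ⟨?_, ?_⟩
  · by_cases hx : x = 0
    · simp [hx]
    have hP := Matrix.posSemidef_vecMulVec_self_star x
    have htr : ∀ A : Matrix n n ℂ, (A * Matrix.vecMulVec x (star x)).trace =
        star x ⬝ᵥ (A.mulVec x) := fun A => by
      rw [Matrix.mul_vecMulVec, Matrix.trace_vecMulVec, dotProduct_comm]
    have hpos : 0 < (star x ⬝ᵥ x) := Matrix.dotProduct_star_self_pos_iff.mpr hx
    have hpos' := Complex.pos_iff.mp hpos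
    set r := (star x ⬝ᵥ x).re with hr
    have hrx : star x ⬝ᵥ x = (r : ℂ) := Complex.ext (by simp [hr]) (by simp [← hpos'.2])
    have hs : IsState (r⁻¹ • Matrix.vecMulVec x (star x)) := by
      refine ⟨posSemidef_real_smul hP (inv_nonneg.mpr hpos'.1.le), ?_⟩
      rw [Matrix.trace_smul, Matrix.trace_vecMulVec, dotProduct_comm, hrx,
        Complex.real_smul, ← Complex.ofReal_mul, inv_mul_cancel₀ hpos'.1.ne', Complex.ofReal_one]
    have h1 := h _ hs
    rw [Matrix.mul_smul, Matrix.trace_smul, htr, Complex.smul_re, smul_eq_mul,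
      inv_mul_le_iff₀ hpos'.1] at h1
    rw [Matrix.sub_mulVec, dotProduct_sub, Matrix.smul_mulVec, Matrix.one_mulVec,
      dotProduct_smul, hrx, Complex.sub_re, Complex.smul_re, Complex.ofReal_re, smul_eq_mul]
    linarith
  · exact (hH.im_star_dotProduct_mulVec_self x).symm

lemma re_trace_mul_le {G σ : Matrix n n ℂ} {t : ℝ}
    (hG : (t • (1 : Matrix n n ℂ) - G).PosSemidef) (hσ : IsState σ) : (G * σ).trace.re ≤ t := by
  have := re_trace_mul_nonneg hG hσ.1
  rw [sub_mul, Matrix.smul_mul, one_mul, Matrix.trace_sub, Matrix.trace_smul, hσ.2,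
    Complex.sub_re, Complex.smul_re, Complex.one_re, smul_eq_mul, mul_one] at this
  linarith

lemma isCompact_effects : IsCompact {Q : Matrix n n ℂ | Q.PosSemidef ∧ (1 - Q).PosSemidef} := by
  refine isCompact_of_posSemidef_of_trace_le
    (isClosed_posSemidef.inter (isClosed_posSemidef.preimage (by fun_prop)))
    (1 : Matrix n n ℂ).trace.re fun A h => ⟨h.1, ?_⟩
  have := re_trace_nonneg h.2
  rw [Matrix.trace_sub, Complex.sub_re] at this
  linarith

/-- A factorization lemma of Douglas type: an operator `0 ≤ F ≤ S²` is of the form `S Q S` with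
`0 ≤ Q ≤ 1`. For invertible `S` take `Q = S⁻¹ F S⁻¹`; in general the set of `δ ∈ [0, 1]` such
that `F = (S + δ) Q (S + δ)` is solvable in `0 ≤ Q ≤ 1` is compact and contains every
`δ > 0`. -/
lemma exists_effect_conj_eq {S F : Matrix n n ℂ} (hS : S.PosSemidef) (hF : F.PosSemidef)
    (hSF : (S * S - F).PosSemidef) :
    ∃ Q : Matrix n n ℂ, Q.PosSemidef ∧ (1 - Q).PosSemidef ∧ S * Q * S = F := by
  let C : Set (ℝ × Matrix n n ℂ) :=
    (Set.Icc 0 1 ×ˢ {Q : Matrix n n ℂ | Q.PosSemidef ∧ (1 - Q).PosSemidef}) ∩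
      {p | (S + p.1 • 1) * p.2 * (S + p.1 • 1) = F}
  have hC : IsCompact C := (isCompact_Icc.prod isCompact_effects).inter_right
    (isClosed_eq (by fun_prop) (by fun_prop))
  have hcl : IsClosed (Prod.fst '' C) := (hC.image continuous_fst).isClosed
  have hsub : Set.Ioc (0 : ℝ) 1 ⊆ Prod.fst '' C := by
    rintro δ ⟨h0, h1⟩
    set T := S + δ • (1 : Matrix n n ℂ) with hT
    have hTpd : T.PosDef := Matrix.PosDef.posSemidef_add hS (Matrix.PosDef.one.smul h0)
    have hdet := (Matrix.isUnit_iff_isUnit_det _).mp hTpd.isUnit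
    have hTi : T⁻¹.IsHermitian := hTpd.isHermitian.inv
    have key : ∀ A : Matrix n n ℂ, A.PosSemidef → (T⁻¹ * A * T⁻¹).PosSemidef := fun A hA => by
      have := hA.mul_mul_conjTranspose_same T⁻¹
      rwa [hTi.eq] at this
    refine ⟨(δ, T⁻¹ * F * T⁻¹), ⟨⟨⟨h0.le, h1⟩, key F hF, ?_⟩, ?_⟩, rfl⟩
    · have e : 1 - T⁻¹ * F * T⁻¹ = T⁻¹ * (T * T - F) * T⁻¹ := by
        rw [mul_sub, sub_mul, ← mul_assoc T⁻¹, Matrix.nonsing_inv_mul _ hdet, one_mul,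
          Matrix.mul_nonsing_inv _ hdet]
      rw [e]
      refine key _ ?_
      have e2 : T * T - F = (S * S - F) + ((2 * δ) • S + (δ * δ) • (1 : Matrix n n ℂ)) := by
        rw [hT, add_mul, mul_add, mul_add]
        simp only [Matrix.mul_smul, Matrix.smul_mul, mul_one, one_mul, smul_smul]
        module
      rw [e2]
      exact hSF.add ((posSemidef_real_smul hS (by positivity)).add
        (posSemidef_real_smul Matrix.PosSemidef.one (by positivity)))
    · change T * (T⁻¹ * F * T⁻¹) * T = F
      rw [mul_assoc T⁻¹, Matrix.mul_nonsing_inv_cancel_left _ _ hdet,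
        Matrix.nonsing_inv_mul_cancel_right _ _ hdet]
  have h0 : (0 : ℝ) ∈ Prod.fst '' C := by
    have := hcl.closure_subset_iff.mpr hsub
    rw [closure_Ioc zero_ne_one] at this
    exact this ⟨le_rfl, zero_le_one⟩
  obtain ⟨⟨δ, Q⟩, ⟨⟨-, hQ⟩, hQF⟩, rfl : δ = 0⟩ := h0
  refine ⟨Q, hQ.1, hQ.2, ?_⟩
  simpa using hQF

end PosSemidef

/-! ### Choi operators and partial traces -/

section Choi

variable {a b : Type*}

/-- The Choi operator `∑ i j, |i⟩⟨j| ⊗ N(|i⟩⟨j|)` of a linear map `N`, unnormalized. -/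
def choi [DecidableEq a] (N : Matrix a a ℂ →ₗ[ℂ] Matrix b b ℂ) : Matrix (a × b) (a × b) ℂ :=
  Matrix.of fun x y => N (Matrix.single x.1 y.1 1) x.2 y.2

lemma choi_apply [DecidableEq a] (N : Matrix a a ℂ →ₗ[ℂ] Matrix b b ℂ) (i j : a) (p q : b) :
    choi N (i, p) (j, q) = N (Matrix.single i j 1) p q := rfl

/-- A linear map is determined by its Choi operator. -/
lemma map_apply_eq_sum_choi [Fintype a] [DecidableEq a] (N : Matrix a a ℂ →ₗ[ℂ] Matrix b b ℂ)
    (X : Matrix a a ℂ) (p q : b) :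
    N X p q = ∑ i, ∑ j, X i j * choi N (i, p) (j, q) := by
  conv_lhs => rw [Matrix.matrix_eq_sum_single X]
  simp only [map_sum, Matrix.sum_apply]
  refine Finset.sum_congr rfl fun i _ => Finset.sum_congr rfl fun j _ => ?_
  rw [choi_apply, ← smul_eq_mul, ← Matrix.smul_apply, ← map_smul]
  simp

/-- The Choi operator of a completely positive map is positive semidefinite, being the image of
a rank-one operator under `id ⊗ N`. -/
lemma IsCompletelyPositive.choi_posSemidef [Fintype a] [DecidableEq a]
    {N : Matrix a a ℂ →ₗ[ℂ] Matrix b b ℂ} (hN : IsCompletelyPositive N) :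
    (choi N).PosSemidef := by
  let e := Fintype.equivFin a
  let v : Fin (Fintype.card a) × a → ℂ := fun x => if e.symm x.1 = x.2 then 1 else 0
  have h := hN _ _ (Matrix.posSemidef_vecMulVec_self_star v)
  have h2 := h.submatrix (fun x : a × b => (e x.1, x.2))
  convert h2 using 1
  ext ⟨i, p⟩ ⟨j, q⟩
  simp only [choi_apply, Matrix.submatrix_apply, idTensor, LinearMap.coe_mk, AddHom.coe_mk,
    Matrix.of_apply]
  refine congrFun (congrFun (congrArg N ?_) p) q
  ext u w
  simp [Matrix.single_apply, Matrix.vecMulVec_apply, v, ite_and]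
  split_ifs <;> rfl

variable [Fintype a] [Fintype b]

lemma trace_traceLeft (X : Matrix (a × b) (a × b) ℂ) : (traceLeft X).trace = X.trace := by
  simp [traceLeft, Matrix.trace, Fintype.sum_prod_type_right]

lemma trace_traceRight (X : Matrix (a × b) (a × b) ℂ) : (traceRight X).trace = X.trace := by
  simp [traceRight, Matrix.trace, Fintype.sum_prod_type]

omit [Fintype b] in
lemma traceLeft_add (X Y : Matrix (a × b) (a × b) ℂ) :
    traceLeft (X + Y) = traceLeft X + traceLeft Y := by
  ext; simp [traceLeft, Finset.sum_add_distrib]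

omit [Fintype b] in
lemma traceLeft_smul (c : ℝ) (X : Matrix (a × b) (a × b) ℂ) :
    traceLeft (c • X) = c • traceLeft X := by
  ext; simp [traceLeft, Finset.mul_sum]

omit [Fintype b] in
lemma traceLeft_isHermitian {X : Matrix (a × b) (a × b) ℂ} (h : X.IsHermitian) :
    (traceLeft X).IsHermitian := by
  ext p q
  simp only [traceLeft, Matrix.conjTranspose_apply, Matrix.of_apply, star_sum]
  exact Finset.sum_congr rfl fun i _ => h.apply _ _

omit [Fintype b] in
@[fun_prop]
lemma continuous_traceLeft :
    Continuous (traceLeft : Matrix (a × b) (a × b) ℂ → Matrix b b ℂ) :=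
  continuous_matrix fun _ _ => by unfold traceLeft; simp only [Matrix.of_apply]; fun_prop

omit [Fintype b] in
lemma traceLeft_kronecker (τ : Matrix a a ℂ) (Y : Matrix b b ℂ) :
    traceLeft (τ ⊗ₖ Y) = τ.trace • Y := by
  ext p q
  simp [traceLeft, Matrix.trace, Finset.sum_mul]

lemma trace_mul_one_kronecker [DecidableEq a] (F : Matrix (a × b) (a × b) ℂ) (σ : Matrix b b ℂ) :
    (F * ((1 : Matrix a a ℂ) ⊗ₖ σ)).trace = (traceLeft F * σ).trace := by
  have h : ∀ (i : a) (p : b), ∑ x, F (i, p) x * ((1 : Matrix a a ℂ) ⊗ₖ σ) x (i, p) =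
      ∑ q, F (i, p) (i, q) * σ q p := fun i p => by
    rw [Fintype.sum_prod_type_right]
    simp [Matrix.one_apply]
  rw [Matrix.trace, Fintype.sum_prod_type_right]
  simp only [Matrix.trace, Matrix.diag_apply, Matrix.mul_apply, h, traceLeft, Matrix.of_apply,
    Finset.sum_mul]
  exact Finset.sum_congr rfl fun p _ => Finset.sum_comm

end Choi

/-! ### Hypothesis tests on the purified channel output -/

section Purification

variable {a b : Type*} [Fintype a] [DecidableEq a]

omit [DecidableEq a] in
lemma IsState.transpose {ρ : Matrix a a ℂ} (h : IsState ρ) : IsState ρ.transpose :=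
  ⟨h.1.transpose, by rw [Matrix.trace_transpose, h.2]⟩

lemma purification_apply (ρ : Matrix a a ℂ) (i j u v : a) :
    purification ρ (i, u) (j, v) = CFC.sqrt ρ u i * CFC.sqrt ρ j v := by
  have h : maxEntangled a = Matrix.vecMulVec (fun x : a × a => if x.1 = x.2 then 1 else 0)
      (fun x : a × a => if x.1 = x.2 then 1 else 0) := by
    ext ⟨i, u⟩ ⟨j, v⟩
    simp [maxEntangled, Matrix.sum_apply, Matrix.single_apply, Matrix.vecMulVec_apply, ite_and]
    split_ifs <;> rfl
  rw [purification, h, Matrix.mul_vecMulVec, Matrix.vecMulVec_mul, Matrix.vecMulVec_apply]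
  congr 1
  · simp [Matrix.mulVec, dotProduct, Fintype.sum_prod_type, Matrix.one_apply]
  · simp [Matrix.vecMul, dotProduct, Fintype.sum_prod_type, Matrix.one_apply]

lemma sqrt_mul_sqrt {ρ : Matrix a a ℂ} (h : ρ.PosSemidef) : CFC.sqrt ρ * CFC.sqrt ρ = ρ :=
  CFC.sqrt_mul_sqrt_self ρ h.nonneg

lemma traceRight_purification {ρ : Matrix a a ℂ} (h : ρ.PosSemidef) :
    traceRight (purification ρ) = ρ.transpose := by
  ext i j
  rw [Matrix.transpose_apply]
  conv_rhs => rw [← sqrt_mul_sqrt h]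
  simp [traceRight, purification_apply, Matrix.mul_apply, mul_comm]

variable [Fintype b] [DecidableEq b]

/-- The output of the channel on the canonical purification, in terms of the Choi operator. The
transpose occurs because `(1 ⊗ √ρ)` acts on the maximally entangled vector as `√ρᵀ ⊗ 1`. -/
lemma idTensor_purification (N : Matrix a a ℂ →ₗ[ℂ] Matrix b b ℂ) (ρ : Matrix a a ℂ) :
    idTensor a N (purification ρ) =
      ((CFC.sqrt ρ).transpose ⊗ₖ (1 : Matrix b b ℂ)) * choi N *
        ((CFC.sqrt ρ).transpose ⊗ₖ (1 : Matrix b b ℂ)) := by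
  ext ⟨i, p⟩ ⟨j, q⟩
  simp only [idTensor, LinearMap.coe_mk, AddHom.coe_mk, Matrix.of_apply, purification_apply]
  rw [map_apply_eq_sum_choi]
  simp only [Matrix.of_apply, Matrix.mul_apply, Fintype.sum_prod_type, Matrix.kroneckerMap_apply,
    Matrix.transpose_apply, Matrix.one_apply, mul_ite, mul_one, mul_zero, ite_mul, zero_mul,
    Finset.sum_ite_eq, Finset.sum_ite_eq', Finset.mem_univ, if_true, Finset.sum_mul]
  rw [Finset.sum_comm]
  exact Finset.sum_congr rfl fun v _ => Finset.sum_congr rfl fun u _ => by ring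

/-- The operators `0 ≤ F ≤ τ ⊗ 1` that, as functionals of the Choi operator of the channel,
describe the tests of type-I error at most `ε` for the input whose reference state is `τ`. -/
def testSet (N : Matrix a a ℂ →ₗ[ℂ] Matrix b b ℂ) (ε : ℝ) (τ : Matrix a a ℂ) :
    Set (Matrix (a × b) (a × b) ℂ) :=
  {F | (F.PosSemidef ∧ (τ ⊗ₖ 1 - F).PosSemidef) ∧ 1 - (F * choi N).trace.re ≤ ε}

/-- Conjugation by the square root of the reference state turns tests `Q` into operators
`F = (√ρᵀ ⊗ 1) Q (√ρᵀ ⊗ 1)`, so that the type-II error becomes linear in the second state. -/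
lemma typeIIError_eq_sInf_testSet (N : Matrix a a ℂ →ₗ[ℂ] Matrix b b ℂ) (ε : ℝ)
    {ρ : Matrix a a ℂ} (hρ : ρ.PosSemidef) (σ : Matrix b b ℂ) :
    typeIIError ε (idTensor a N (purification ρ)) (traceRight (purification ρ) ⊗ₖ σ) =
      sInf ((fun F => (traceLeft F * σ).trace.re) '' testSet N ε ρ.transpose) := by
  have hS0 : (CFC.sqrt ρ).transpose.PosSemidef :=
    (Matrix.nonneg_iff_posSemidef.mp (CFC.sqrt_nonneg ρ)).transpose
  set S := (CFC.sqrt ρ).transpose ⊗ₖ (1 : Matrix b b ℂ) with hSdef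
  have hS : S.PosSemidef := hS0.kronecker Matrix.PosSemidef.one
  have hSS : ∀ Y : Matrix b b ℂ, S * ((1 : Matrix a a ℂ) ⊗ₖ Y) * S = ρ.transpose ⊗ₖ Y := by
    intro Y
    rw [hSdef, ← Matrix.mul_kronecker_mul, ← Matrix.mul_kronecker_mul, mul_one, mul_one, one_mul,
      ← Matrix.transpose_mul, sqrt_mul_sqrt hρ]
  have hcyc : ∀ Q X : Matrix (a × b) (a × b) ℂ,
      (Q * (S * X * S)).trace = (S * Q * S * X).trace := fun Q X => by
    rw [← mul_assoc, Matrix.trace_mul_comm, ← mul_assoc, ← mul_assoc]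
  rw [typeIIError, idTensor_purification, traceRight_purification hρ]
  congr 1
  ext t
  rw [← hSdef, ← hSS σ]
  simp only [hcyc, trace_mul_one_kronecker, Set.mem_ofPred_eq, Set.mem_image, testSet]
  have h1 : S * S = ρ.transpose ⊗ₖ (1 : Matrix b b ℂ) := by
    have := hSS 1
    rwa [Matrix.one_kronecker_one, mul_one] at this
  constructor
  · rintro ⟨Q, hQ, hQ1, hε, rfl⟩
    have hconj : ∀ A : Matrix (a × b) (a × b) ℂ, A.PosSemidef → (S * A * S).PosSemidef :=
      fun A hA => by
        have := hA.mul_mul_conjTranspose_same S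
        rwa [hS.isHermitian.eq] at this
    refine ⟨S * Q * S, ⟨⟨hconj Q hQ, ?_⟩, hε⟩, rfl⟩
    have := hconj _ hQ1
    rwa [mul_sub, sub_mul, mul_one, h1] at this
  · rintro ⟨F, ⟨⟨hF, hF1⟩, hε⟩, rfl⟩
    rw [← h1] at hF1
    obtain ⟨Q, hQ, hQ1, rfl⟩ := exists_effect_conj_eq hS hF hF1
    exact ⟨Q, hQ, hQ1, hε, rfl⟩

end Purification

/-! ### Minimax and compactness -/

section Optimum

variable {a b : Type*} [Fintype a] [Fintype b] [DecidableEq b]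

omit [Fintype a] [Fintype b] in
@[fun_prop]
lemma continuous_kronecker_one :
    Continuous fun τ : Matrix a a ℂ => τ ⊗ₖ (1 : Matrix b b ℂ) :=
  continuous_matrix fun x y => by
    simp only [Matrix.kroneckerMap_apply]
    exact (continuous_id.matrix_elem x.1 y.1).mul continuous_const

lemma trace_kronecker_one {τ : Matrix a a ℂ} (hτ : IsState τ) :
    (τ ⊗ₖ (1 : Matrix b b ℂ)).trace = Fintype.card b := by
  rw [Matrix.trace_kronecker, hτ.2, one_mul, Matrix.trace_one]

lemma re_trace_le_card {τ : Matrix a a ℂ} (hτ : IsState τ) {F : Matrix (a × b) (a × b) ℂ}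
    (hF : (τ ⊗ₖ 1 - F).PosSemidef) : F.trace.re ≤ Fintype.card b := by
  have := re_trace_nonneg hF
  rw [Matrix.trace_sub, trace_kronecker_one hτ, Complex.sub_re, Complex.natCast_re] at this
  linarith

variable (a b) in
/-- The pairs of a state `τ` and an operator `0 ≤ F ≤ τ ⊗ 1`. -/
def dominatedPairs : Set (Matrix a a ℂ × Matrix (a × b) (a × b) ℂ) :=
  {x | IsState x.1 ∧ x.2.PosSemidef ∧ (x.1 ⊗ₖ 1 - x.2).PosSemidef}

lemma isClosed_dominatedPairs : IsClosed (dominatedPairs a b) :=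
  (isClosed_isState.preimage continuous_fst).inter
    ((isClosed_posSemidef.preimage continuous_snd).inter
      (isClosed_posSemidef.preimage (by fun_prop)))

lemma isCompact_dominatedPairs : IsCompact (dominatedPairs a b) := by
  have h : IsCompact {F : Matrix (a × b) (a × b) ℂ | F.PosSemidef ∧
      F.trace.re ≤ Fintype.card b} :=
    isCompact_of_posSemidef_of_trace_le (isClosed_posSemidef.inter
      (isClosed_Iic.preimage (f := fun F : Matrix (a × b) (a × b) ℂ => F.trace.re) (by fun_prop))) _ fun _ h => h
  exact (isCompact_isState.prod h).of_isClosed_subset isClosed_dominatedPairs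
    fun x hx => ⟨hx.1, hx.2.1, re_trace_le_card hx.1 hx.2.2⟩

variable [DecidableEq a]

lemma isCompact_testSet (N : Matrix a a ℂ →ₗ[ℂ] Matrix b b ℂ) (ε : ℝ) {τ : Matrix a a ℂ}
    (hτ : IsState τ) : IsCompact (testSet N ε τ) :=
  isCompact_of_posSemidef_of_trace_le
    ((isClosed_posSemidef.inter (isClosed_posSemidef.preimage (by fun_prop))).inter
      (isClosed_Iic.preimage (f := fun F => 1 - (F * choi N).trace.re) (by fun_prop)))
    (Fintype.card b)
    fun _ h => ⟨h.1.1, re_trace_le_card hτ h.1.2⟩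

lemma convex_testSet (N : Matrix a a ℂ →ₗ[ℂ] Matrix b b ℂ) (ε : ℝ) (τ : Matrix a a ℂ) :
    Convex ℝ (testSet N ε τ) := by
  rintro F ⟨⟨hF, hF1⟩, hFε⟩ G ⟨⟨hG, hG1⟩, hGε⟩ s t hs ht hst
  refine ⟨⟨convex_posSemidef hF hG hs ht hst, ?_⟩, ?_⟩
  · have e : τ ⊗ₖ (1 : Matrix b b ℂ) - (s • F + t • G) =
        s • (τ ⊗ₖ (1 : Matrix b b ℂ) - F) + t • (τ ⊗ₖ (1 : Matrix b b ℂ) - G) := by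
      obtain rfl : t = 1 - s := by linarith
      module
    rw [e]
    exact convex_posSemidef hF1 hG1 hs ht hst
  · rw [add_mul, Matrix.smul_mul, Matrix.smul_mul, Matrix.trace_add, Matrix.trace_smul,
      Matrix.trace_smul, Complex.add_re, Complex.smul_re, Complex.smul_re, smul_eq_mul,
      smul_eq_mul]
    have h1 := mul_le_mul_of_nonneg_left hFε hs
    have h2 := mul_le_mul_of_nonneg_left hGε ht
    obtain rfl : t = 1 - s := by linarith
    nlinarith

/-- The trivial test `F = τ ⊗ 1` has no type-I error. -/
lemma trace_kronecker_one_mul_choi {N : Matrix a a ℂ →ₗ[ℂ] Matrix b b ℂ} (hN : IsChannel N)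
    {τ : Matrix a a ℂ} (hτ : IsState τ) : (τ ⊗ₖ (1 : Matrix b b ℂ) * choi N).trace = 1 := by
  have h : ∀ i j, ∑ p, choi N (j, p) (i, p) = if j = i then 1 else 0 := fun i j => by
    have := hN.trace_preserving (Matrix.single j i 1)
    rw [Matrix.trace, Matrix.trace] at this
    simpa [choi, Matrix.single_apply, ite_and, eq_comm] using this
  rw [← hτ.2]
  simp only [Matrix.trace, Matrix.diag_apply, Matrix.mul_apply, Fintype.sum_prod_type,
    Matrix.kroneckerMap_apply, Matrix.one_apply, mul_ite, mul_one, mul_zero, ite_mul, zero_mul,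
    Finset.sum_ite_eq, Finset.mem_univ, if_true]
  refine Finset.sum_congr rfl fun i _ => ?_
  rw [Finset.sum_comm]
  simp [← Finset.mul_sum, h]

lemma kronecker_one_mem_testSet {N : Matrix a a ℂ →ₗ[ℂ] Matrix b b ℂ} (hN : IsChannel N)
    {ε : ℝ} (hε : 0 ≤ ε) {τ : Matrix a a ℂ} (hτ : IsState τ) :
    τ ⊗ₖ (1 : Matrix b b ℂ) ∈ testSet N ε τ :=
  ⟨⟨hτ.1.kronecker Matrix.PosSemidef.one, by rw [sub_self]; exact Matrix.PosSemidef.zero⟩, by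
    rw [trace_kronecker_one_mul_choi hN hτ]; simpa⟩

/-- The minimax theorem for the type-II error: for a fixed reference state there is a test that
is optimal against all output states simultaneously, and a least favourable output state. -/
lemma exists_isSaddlePointOn_testSet [Nonempty b] {N : Matrix a a ℂ →ₗ[ℂ] Matrix b b ℂ}
    (hN : IsChannel N) {ε : ℝ} (hε : 0 ≤ ε) {τ : Matrix a a ℂ} (hτ : IsState τ) :
    ∃ F ∈ testSet N ε τ, ∃ σ ∈ {σ : Matrix b b ℂ | IsState σ},
      IsSaddlePointOn (testSet N ε τ) {σ : Matrix b b ℂ | IsState σ}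
        (fun F σ => (traceLeft F * σ).trace.re) F σ := by
  have hl : ∀ σ : Matrix b b ℂ, IsLinearMap ℝ
      fun F : Matrix (a × b) (a × b) ℂ => (traceLeft F * σ).trace.re := fun σ =>
    ⟨fun F G => by simp [traceLeft_add, add_mul], fun c F => by simp [traceLeft_smul]⟩
  have hr : ∀ F : Matrix (a × b) (a × b) ℂ, IsLinearMap ℝ
      fun σ : Matrix b b ℂ => (traceLeft F * σ).trace.re := fun F =>
    ⟨fun σ σ' => by simp [mul_add], fun c σ => by simp⟩
  refine Sion.exists_isSaddlePointOn ⟨_, kronecker_one_mem_testSet hN hε hτ⟩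
    (convex_testSet N ε τ) (isCompact_testSet N ε hτ) (fun σ _ => ?_) (fun σ _ => ?_)
    convex_isState exists_isState isCompact_isState (fun F _ => ?_) (fun F _ => ?_)
  · exact Continuous.lowerSemicontinuous (by fun_prop) |>.lowerSemicontinuousOn _
  · exact (((hl σ).mk' _).convexOn (convex_testSet N ε τ)).quasiconvexOn
  · exact Continuous.upperSemicontinuous (by fun_prop) |>.upperSemicontinuousOn _
  · exact (((hr F).mk' _).concaveOn convex_isState).quasiconcaveOn

/-- `IsAchievableOverlap N ε η` holds if some operator `0 ≤ F ≤ τ ⊗ 1`, with `τ` a state, has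
overlap at least `1 - ε` with the Choi operator of `N` and output marginal at most `η`. The least
such `η` turns out to be both `2 ^ (-R(N, ε))` and the infimum of the ratios `m / M` for which
`N` together with `m` noiseless classical symbols transmits `M` messages with error `ε`. -/
def IsAchievableOverlap (N : Matrix a a ℂ →ₗ[ℂ] Matrix b b ℂ) (ε η : ℝ) : Prop :=
  ∃ τ, IsState τ ∧ ∃ F ∈ testSet N ε τ, (η • (1 : Matrix b b ℂ) - traceLeft F).PosSemidef

lemma IsAchievableOverlap.pos {N : Matrix a a ℂ →ₗ[ℂ] Matrix b b ℂ} {ε η : ℝ} (hε : ε < 1)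
    (h : IsAchievableOverlap N ε η) : 0 < η := by
  obtain ⟨τ, -, F, ⟨⟨hF, -⟩, hFε⟩, hη⟩ := h
  by_contra! hη0
  have h1 := re_trace_nonneg hη
  rw [Matrix.trace_sub, Matrix.trace_smul, Matrix.trace_one, trace_traceLeft, Complex.sub_re,
    Complex.smul_re, Complex.natCast_re, smul_eq_mul] at h1
  have h2 : η * (Fintype.card b : ℝ) ≤ 0 := mul_nonpos_of_nonpos_of_nonneg hη0 (by positivity)
  have h0 : F = 0 := by
    ext x y
    have := norm_entry_le_re_trace hF x y
    exact norm_le_zero_iff.mp (by linarith)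
  rw [h0] at hFε
  simp at hFε
  linarith

lemma exists_least_isAchievableOverlap [Nonempty a] {N : Matrix a a ℂ →ₗ[ℂ] Matrix b b ℂ}
    (hN : IsChannel N) {ε : ℝ} (hε : ε ∈ Set.Ioo (0 : ℝ) 1) :
    ∃ η, IsLeast {η | IsAchievableOverlap N ε η} η := by
  let D : Set (ℝ × (Matrix a a ℂ × Matrix (a × b) (a × b) ℂ)) :=
    (Set.Icc 0 1 ×ˢ dominatedPairs a b) ∩
      ({x | 1 - (x.2.2 * choi N).trace.re ≤ ε} ∩
        {x | (x.1 • (1 : Matrix b b ℂ) - traceLeft x.2.2).PosSemidef})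
  have hD : IsCompact D := (isCompact_Icc.prod isCompact_dominatedPairs).inter_right
    ((isClosed_le (by fun_prop) (by fun_prop)).inter
      (isClosed_posSemidef.preimage (by fun_prop)))
  have hDη : ∀ η, η ≤ 1 → IsAchievableOverlap N ε η → η ∈ Prod.fst '' D := by
    intro η h1 h
    have h0 := h.pos hε.2
    obtain ⟨τ, hτ, F, hF, hη⟩ := h
    exact ⟨(η, τ, F), ⟨⟨⟨h0.le, h1⟩, hτ, hF.1.1, hF.1.2⟩, hF.2, hη⟩, rfl⟩
  have hone : IsAchievableOverlap N ε 1 := by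
    obtain ⟨τ, hτ⟩ := exists_isState (n := a)
    refine ⟨τ, hτ, _, kronecker_one_mem_testSet hN hε.1.le hτ, ?_⟩
    rw [traceLeft_kronecker, hτ.2, one_smul, one_smul, sub_self]
    exact Matrix.PosSemidef.zero
  obtain ⟨η, hη, hmin⟩ := (hD.image continuous_fst).exists_isLeast ⟨1, hDη 1 le_rfl hone⟩
  obtain ⟨⟨η', τ, F⟩, ⟨⟨h01, hτ, hF, hF1⟩, hFε, hFη⟩, rfl⟩ := hη
  refine ⟨η', ⟨τ, hτ, F, ⟨⟨hF, hF1⟩, hFε⟩, hFη⟩, fun x hx => ?_⟩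
  by_cases hx1 : x ≤ 1
  · exact hmin (hDη x hx1 hx)
  · exact h01.2.trans (not_le.mp hx1).le

/-! ### Evaluation of the meta-converse -/

lemma hypTestEntropy_anti {c d : Type*} [Fintype c] [DecidableEq c] [Fintype d] [DecidableEq d]
    {ε ε' : ℝ} {ρ₀ ρ₁ : Matrix c c ℂ} {σ₀ σ₁ : Matrix d d ℂ} (h0 : 0 ≤ typeIIError ε ρ₀ ρ₁)
    (h : typeIIError ε ρ₀ ρ₁ ≤ typeIIError ε' σ₀ σ₁) :
    hypTestEntropy ε' σ₀ σ₁ ≤ hypTestEntropy ε ρ₀ ρ₁ := by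
  unfold hypTestEntropy
  by_cases h1 : typeIIError ε ρ₀ ρ₁ = 0
  · simp [h1]
  have hpos := lt_of_le_of_ne h0 (Ne.symm h1)
  rw [if_neg h1, if_neg (hpos.trans_le h).ne', EReal.coe_le_coe_iff, neg_le_neg_iff]
  exact Real.logb_le_logb_of_le one_lt_two hpos h

/-- The value of the saddle point of the type-II error determines the inner optimum of the
meta-converse. -/
lemma exists_metaInner_eq [Nonempty b] {N : Matrix a a ℂ →ₗ[ℂ] Matrix b b ℂ}
    (hN : IsChannel N) {ε : ℝ} (hε : ε ∈ Set.Ioo (0 : ℝ) 1) {ρ : Matrix a a ℂ} (hρ : IsState ρ) :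
    ∃ β : ℝ, IsAchievableOverlap N ε β ∧ metaInner N ε ρ = ((-Real.logb 2 β : ℝ) : EReal) ∧
      (∃ σ, IsState σ ∧ metaObjective N ε ρ σ = metaInner N ε ρ) ∧
      ∀ η, (∃ F ∈ testSet N ε ρ.transpose,
        (η • (1 : Matrix b b ℂ) - traceLeft F).PosSemidef) → β ≤ η := by
  obtain ⟨F, hF, σ, hσ, hsad⟩ := exists_isSaddlePointOn_testSet hN hε.1.le hρ.transpose
  have hpos : ∀ σ' : Matrix b b ℂ, IsState σ' →
      ∀ t ∈ (fun F => (traceLeft F * σ').trace.re) '' testSet N ε ρ.transpose, 0 ≤ t := by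
    rintro σ' hσ' _ ⟨G, hG, rfl⟩
    change 0 ≤ (traceLeft G * σ').trace.re
    rw [← trace_mul_one_kronecker]
    exact re_trace_mul_nonneg hG.1.1 (Matrix.PosSemidef.one.kronecker hσ'.1)
  have hnonneg : ∀ σ' : Matrix b b ℂ, IsState σ' → 0 ≤ typeIIError ε
      (idTensor a N (purification ρ)) (traceRight (purification ρ) ⊗ₖ σ') := by
    intro σ' hσ'
    rw [typeIIError_eq_sInf_testSet N ε hρ.1]
    exact Real.sInf_nonneg (hpos σ' hσ')
  set β := (traceLeft F * σ).trace.re with hβ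
  have hval : typeIIError ε (idTensor a N (purification ρ))
      (traceRight (purification ρ) ⊗ₖ σ) = β := by
    rw [typeIIError_eq_sInf_testSet N ε hρ.1]
    refine IsLeast.csInf_eq ⟨⟨F, hF, rfl⟩, ?_⟩
    rintro _ ⟨G, hG, rfl⟩
    exact hsad G hG σ hσ
  have hle : ∀ σ', IsState σ' → typeIIError ε (idTensor a N (purification ρ))
      (traceRight (purification ρ) ⊗ₖ σ') ≤ β := by
    intro σ' hσ'
    rw [typeIIError_eq_sInf_testSet N ε hρ.1]
    exact (csInf_le ⟨0, hpos σ' hσ'⟩ ⟨F, hF, rfl⟩).trans (hsad F hF σ' hσ')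
  have hβa : IsAchievableOverlap N ε β :=
    ⟨_, hρ.transpose, F, hF, posSemidef_smul_one_sub
      (traceLeft_isHermitian hF.1.1.isHermitian) fun σ' hσ' => hsad F hF σ' hσ'⟩
  have hinner : metaObjective N ε ρ σ = metaInner N ε ρ := by
    refine le_antisymm (le_iInf₂ fun σ' hσ' => ?_) (iInf₂_le σ hσ)
    exact hypTestEntropy_anti (hnonneg σ' hσ') ((hle σ' hσ').trans hval.ge)
  refine ⟨β, hβa, ?_, ⟨σ, hσ, hinner⟩, ?_⟩
  · rw [← hinner, metaObjective, hypTestEntropy, hval, if_neg (hβa.pos hε.2).ne']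
  · rintro η ⟨G, hG, hGη⟩
    exact (hsad G hG σ hσ).trans (re_trace_mul_le hGη hσ)

/-- The meta-converse is `-log₂` of the least achievable overlap, and it is attained. -/
lemma exists_metaInner_eq_metaConverse [Nonempty b] {N : Matrix a a ℂ →ₗ[ℂ] Matrix b b ℂ}
    (hN : IsChannel N) {ε : ℝ} (hε : ε ∈ Set.Ioo (0 : ℝ) 1) {η : ℝ}
    (hη : IsLeast {η | IsAchievableOverlap N ε η} η) :
    metaConverse N ε = ((-Real.logb 2 η : ℝ) : EReal) ∧
      ∃ ρ, IsState ρ ∧ metaInner N ε ρ = metaConverse N ε := by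
  have hηpos := hη.1.pos hε.2
  have hub : metaConverse N ε ≤ ((-Real.logb 2 η : ℝ) : EReal) := by
    refine iSup₂_le fun ρ hρ => ?_
    obtain ⟨β, hβ, heq, -, -⟩ := exists_metaInner_eq hN hε hρ
    rw [heq, EReal.coe_le_coe_iff, neg_le_neg_iff]
    exact Real.logb_le_logb_of_le one_lt_two hηpos (hη.2 hβ)
  obtain ⟨τ, hτ, hF⟩ := hη.1
  obtain ⟨β, hβ, heq, -, hmin⟩ := exists_metaInner_eq hN hε hτ.transpose
  rw [Matrix.transpose_transpose] at hmin
  have hle : ((-Real.logb 2 η : ℝ) : EReal) ≤ metaInner N ε τ.transpose := by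
    rw [heq, EReal.coe_le_coe_iff, neg_le_neg_iff]
    exact Real.logb_le_logb_of_le one_lt_two (hβ.pos hε.2) (hmin η hF)
  have hsup : metaInner N ε τ.transpose ≤ metaConverse N ε :=
    le_iSup₂ (f := fun ρ (_ : IsState ρ) => metaInner N ε ρ) _ hτ.transpose
  exact ⟨le_antisymm hub (hle.trans hsup), _, hτ.transpose,
    le_antisymm hsup (hub.trans hle)⟩

end Optimum

section Codes

variable {a b : Type*} [Fintype a] [Fintype b] [DecidableEq a] [DecidableEq b] {M : ℕ}

/-! ### Dominated pairs from codes -/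

/-- The block of the Choi operator of a code that belongs to message `k` and estimate `l`. -/
def codeBlock (P : Matrix (Fin M × b) (Fin M × b) ℂ →ₗ[ℂ] Matrix (a × Fin M) (a × Fin M) ℂ)
    (k l : Fin M) : Matrix (a × b) (a × b) ℂ :=
  (choi P).submatrix (fun x => ((k, x.2), (x.1, l))) (fun x => ((k, x.2), (x.1, l)))

/-- The average of the blocks of a code that belong to correct estimates. -/
def codeOperator (P : Matrix (Fin M × b) (Fin M × b) ℂ →ₗ[ℂ] Matrix (a × Fin M) (a × Fin M) ℂ) :
    Matrix (a × b) (a × b) ℂ :=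
  (M : ℝ)⁻¹ • ∑ k, codeBlock P k k

omit [DecidableEq a] [DecidableEq b] [Fintype b] in
lemma trace_transpose_mul (A B : Matrix a a ℂ) :
    (A.transpose * B).trace = ∑ x, ∑ y, A x y * B x y := by
  simp only [Matrix.trace, Matrix.diag_apply, Matrix.mul_apply, Matrix.transpose_apply]
  exact Finset.sum_comm

/-- The success probability is linear in the Choi operators of the code and of the channel. -/
lemma successProb_eq
    (P : Matrix (Fin M × b) (Fin M × b) ℂ →ₗ[ℂ] Matrix (a × Fin M) (a × Fin M) ℂ)
    (N : Matrix a a ℂ →ₗ[ℂ] Matrix b b ℂ) :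
    successProb P N = ((codeOperator P).transpose * choi N).trace.re := by
  have h : ∀ k : Fin M, (effective P N (Matrix.single k k 1) * Matrix.single k k 1).trace =
      ((codeBlock P k k).transpose * choi N).trace := by
    intro k
    have h1 : (effective P N (Matrix.single k k 1) * Matrix.single k k 1).trace =
        effective P N (Matrix.single k k 1) k k := by
      rw [Matrix.trace_mul_comm, Matrix.trace_single_mul, one_smul]
    have h2 : effective P N (Matrix.single k k 1) k k = ∑ p, ∑ q, ∑ i, ∑ j,
        codeBlock P k k (i, p) (j, q) * choi N (i, p) (j, q) := by
      simp only [effective, Matrix.sum_apply]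
      refine Finset.sum_congr rfl fun p _ => Finset.sum_congr rfl fun q _ => ?_
      refine (map_apply_eq_sum_choi N _ p q).trans ?_
      simp only [Matrix.of_apply, Matrix.single_kronecker_single, mul_one, codeBlock,
        Matrix.submatrix_apply, choi_apply]
    rw [h1, h2, trace_transpose_mul]
    simp only [Fintype.sum_prod_type]
    refine (Finset.sum_congr rfl fun p _ => Finset.sum_comm).trans (Finset.sum_comm.trans ?_)
    exact Finset.sum_congr rfl fun i _ => Finset.sum_congr rfl fun p _ => Finset.sum_comm
  rw [successProb, codeOperator, Matrix.transpose_smul, Matrix.transpose_sum, Matrix.smul_mul,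
    Matrix.sum_mul, Matrix.trace_smul, Matrix.trace_sum, Complex.smul_re, Complex.re_sum, one_div,
    smul_eq_mul]
  simp only [h]

lemma traceRight_single (k : Fin M) (p q : b) :
    traceRight (Matrix.single (k, p) (k, q) (1 : ℂ)) =
      if p = q then Matrix.single k k 1 else 0 := by
  ext i j
  by_cases h : p = q
  · subst h
    simp [traceRight, Matrix.single_apply, ite_and]
  · simp only [traceRight, Matrix.of_apply, h, if_false, Matrix.zero_apply, Matrix.single_apply,
      Prod.mk.injEq]
    refine Finset.sum_eq_zero fun x _ => if_neg ?_
    rintro ⟨⟨-, rfl⟩, -, rfl⟩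
    exact h rfl

omit [Fintype b] in
lemma traceLeft_single (k : Fin M) (p q : b) :
    traceLeft (Matrix.single (k, p) (k, q) (1 : ℂ)) = Matrix.single p q 1 := by
  ext i j
  simp [traceLeft, Matrix.single_apply, ite_and]

/-- A no-signalling code of size `M` yields a pair `0 ≤ F ≤ τ ⊗ 1` whose marginal is `1 / M`. No
signalling from Bob to Alice provides the state `τ`; no signalling from Alice to Bob makes the
marginal proportional to the identity. -/
lemma IsNSCode.exists_dominatedPair [Nonempty b] (hM : 1 ≤ M)
    {P : Matrix (Fin M × b) (Fin M × b) ℂ →ₗ[ℂ] Matrix (a × Fin M) (a × Fin M) ℂ}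
    (hP : IsNSCode P) (N : Matrix a a ℂ →ₗ[ℂ] Matrix b b ℂ) :
    ∃ x ∈ dominatedPairs a b, traceLeft x.2 = (M : ℝ)⁻¹ • (1 : Matrix b b ℂ) ∧
      successProb P N = (x.2 * choi N).trace.re := by
  have hchoi := hP.isChannel.completelyPositive.choi_posSemidef
  have hblock : ∀ k l, (codeBlock P k l).PosSemidef := fun k l => hchoi.submatrix _
  have hMpos : (0 : ℝ) < M := by exact_mod_cast hM
  have hMinv : (0 : ℝ) ≤ (M : ℝ)⁻¹ := inv_nonneg.mpr hMpos.le
  obtain ⟨q₀⟩ := ‹Nonempty b›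
  let R : Fin M → Matrix a a ℂ := fun k => traceRight (P (Matrix.single (k, q₀) (k, q₀) 1))
  have hsum : ∀ k, ∑ l, codeBlock P k l = R k ⊗ₖ (1 : Matrix b b ℂ) := by
    intro k
    ext ⟨i, p⟩ ⟨j, q⟩
    have h1 : (∑ l, codeBlock P k l) (i, p) (j, q) =
        traceRight (P (Matrix.single (k, p) (k, q) 1)) i j := by
      simp [Matrix.sum_apply, codeBlock, traceRight, choi_apply]
    rw [h1, Matrix.kroneckerMap_apply, Matrix.one_apply]
    by_cases h : p = q
    · subst h
      rw [if_pos rfl, mul_one]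
      refine congrFun (congrFun (hP.noSignal_bob_to_alice _ _ ?_) i) j
      simp [traceRight_single]
    · rw [if_neg h, mul_zero, hP.noSignal_bob_to_alice _ 0 (by
        rw [traceRight_single, if_neg h]; ext; simp [traceRight]), map_zero]
      simp [traceRight]
  have hRtr : ∀ k, (R k).trace = 1 := fun k => by
    simp only [R, trace_traceRight, hP.isChannel.trace_preserving]
    simp [Matrix.trace]
  have hRpos : ∀ k, (R k).PosSemidef := fun k => by
    have h := (Matrix.posSemidef_sum Finset.univ fun l _ => hblock k l).submatrix
      (fun i : a => (i, q₀))
    rw [hsum k] at h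
    convert h using 1
    ext i j
    simp
  let ρ : Matrix a a ℂ := (M : ℝ)⁻¹ • ∑ k, R k
  have hρ : IsState ρ := by
    refine ⟨posSemidef_real_smul (Matrix.posSemidef_sum _ fun k _ => hRpos k) hMinv, ?_⟩
    simp only [ρ, Matrix.trace_smul, Matrix.trace_sum, hRtr]
    simp only [Finset.sum_const, Finset.card_univ, Fintype.card_fin, nsmul_eq_mul, mul_one,
      Complex.real_smul, Complex.ofReal_inv, Complex.ofReal_natCast]
    exact inv_mul_cancel₀ (Nat.cast_ne_zero.mpr (by omega))
  have hF : (codeOperator P).PosSemidef :=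
    posSemidef_real_smul (Matrix.posSemidef_sum _ fun k _ => hblock k k) hMinv
  have hdom : (ρ ⊗ₖ (1 : Matrix b b ℂ) - codeOperator P).PosSemidef := by
    have e : ρ ⊗ₖ (1 : Matrix b b ℂ) - codeOperator P =
        (M : ℝ)⁻¹ • ∑ k, ∑ l ∈ Finset.univ.erase k, codeBlock P k l := by
      have e1 : ρ ⊗ₖ (1 : Matrix b b ℂ) = (M : ℝ)⁻¹ • ∑ k, R k ⊗ₖ (1 : Matrix b b ℂ) := by
        ext x y
        simp [ρ, Matrix.sum_apply, Finset.sum_mul, mul_assoc]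
      rw [e1, codeOperator, ← smul_sub, ← Finset.sum_sub_distrib]
      simp only [Finset.sum_erase_eq_sub (Finset.mem_univ _), hsum]
    rw [e]
    exact posSemidef_real_smul (Matrix.posSemidef_sum _ fun k _ =>
      Matrix.posSemidef_sum _ fun l _ => hblock k l) hMinv
  have hmarg : traceLeft (codeOperator P) = (M : ℝ)⁻¹ • (1 : Matrix b b ℂ) := by
    rw [codeOperator, traceLeft_smul]
    congr 1
    ext p q
    let k₀ : Fin M := ⟨0, hM⟩
    have h1 : traceLeft (∑ k, codeBlock P k k) p q =
        ∑ k, traceLeft (P (Matrix.single (k, p) (k, q) 1)) k k := by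
      simp only [traceLeft, Matrix.sum_apply, codeBlock, Matrix.of_apply, Matrix.submatrix_apply,
        choi_apply]
      exact Finset.sum_comm
    have h2 : ∀ k, traceLeft (P (Matrix.single (k, p) (k, q) 1)) =
        traceLeft (P (Matrix.single (k₀, p) (k₀, q) 1)) := fun k =>
      hP.noSignal_alice_to_bob _ _ (by rw [traceLeft_single, traceLeft_single])
    have h3 := trace_traceLeft (P (Matrix.single (k₀, p) (k₀, q) 1))
    rw [hP.isChannel.trace_preserving, ← trace_traceLeft (Matrix.single _ _ _),
      traceLeft_single] at h3
    rw [h1]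
    simp only [h2]
    refine Eq.trans h3 ?_
    by_cases h : p = q
    · subst h; simp [Matrix.trace]
    · simp [Matrix.trace, h]
  refine ⟨(ρ.transpose, (codeOperator P).transpose), ⟨hρ.transpose, hF.transpose, ?_⟩, ?_,
    successProb_eq P N⟩
  · have := hdom.transpose
    rwa [Matrix.transpose_sub, ← Matrix.kroneckerMap_transpose, Matrix.transpose_one] at this
  · have := congrArg Matrix.transpose hmarg
    rw [Matrix.transpose_smul, Matrix.transpose_one] at this
    exact this

/-! ### Maps with a given Choi operator -/

/-- The linear map with a given Choi operator. -/
def mapOfChoi (C : Matrix (a × b) (a × b) ℂ) : Matrix a a ℂ →ₗ[ℂ] Matrix b b ℂ where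
  toFun X := Matrix.of fun s t => ∑ u, ∑ v, X u v * C (u, s) (v, t)
  map_add' X Y := by ext; simp [add_mul, Finset.sum_add_distrib]
  map_smul' c X := by ext; simp [Finset.mul_sum, mul_assoc]

omit [DecidableEq a] [DecidableEq b] [Fintype b] in
lemma mapOfChoi_apply (C : Matrix (a × b) (a × b) ℂ) (X : Matrix a a ℂ) (s t : b) :
    mapOfChoi C X s t = ∑ u, ∑ v, X u v * C (u, s) (v, t) := rfl

omit [Fintype b] [DecidableEq b] in
lemma choi_mapOfChoi (C : Matrix (a × b) (a × b) ℂ) : choi (mapOfChoi C) = C := by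
  ext ⟨i, p⟩ ⟨j, q⟩
  simp [choi_apply, mapOfChoi_apply, Matrix.single_apply, ite_and]

omit [DecidableEq a] [DecidableEq b] in
lemma posSemidef_sum_sum_submatrix {ι : Type*} [Fintype ι] {A : Matrix a a ℂ}
    (hA : A.PosSemidef) (f : ι → b → a) :
    (∑ u, ∑ v, A.submatrix (f u) (f v)).PosSemidef := by
  classical
  let V : Matrix a b ℂ := ∑ u, (1 : Matrix a a ℂ).submatrix id (f u)
  have h : V.conjTranspose * A * V = ∑ u, ∑ v, A.submatrix (f u) (f v) := by
    simp only [V, Matrix.conjTranspose_sum, Matrix.sum_mul, Matrix.mul_sum]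
    rw [Finset.sum_comm]
    refine Finset.sum_congr rfl fun u _ => Finset.sum_congr rfl fun v _ => ?_
    ext s t
    simp [Matrix.mul_apply, Matrix.one_apply]
  rw [← h]
  exact hA.conjTranspose_mul_mul_same V

omit [DecidableEq a] [DecidableEq b] in
/-- A map with positive semidefinite Choi operator is completely positive: `(id ⊗ Φ)(X)` is a
compression of `X ⊗ C`. -/
lemma isCompletelyPositive_mapOfChoi {C : Matrix (a × b) (a × b) ℂ} (hC : C.PosSemidef) :
    IsCompletelyPositive (mapOfChoi C) := by
  intro k X hX
  have h := posSemidef_sum_sum_submatrix (hX.kronecker hC)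
    (fun (u : a) (r : Fin k × b) => ((r.1, u), (u, r.2)))
  have e : idTensor (Fin k) (mapOfChoi C) X = ∑ u, ∑ v, (X ⊗ₖ C).submatrix
      (fun r : Fin k × b => ((r.1, u), (u, r.2))) (fun r : Fin k × b => ((r.1, v), (v, r.2))) := by
    ext ⟨r, s⟩ ⟨r', t⟩
    simp [Matrix.sum_apply, idTensor, mapOfChoi_apply]
  rw [e]
  exact h

end Codes

/-! ### Codes from dominated pairs -/

section Blocks

variable {n : Type*} {M : ℕ}

/-- The block-diagonal operator on pairs of labels `(k, l)` whose block is `A` if `k = l` and `B`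
otherwise: the general form of an operator diagonal in the labels and invariant under
simultaneous permutations of them. -/
def labelBlocks (M : ℕ) (A B : Matrix n n ℂ) :
    Matrix ((Fin M × Fin M) × n) ((Fin M × Fin M) × n) ℂ :=
  Matrix.diagonal (fun x : Fin M × Fin M => if x.1 = x.2 then (1 : ℂ) else 0) ⊗ₖ A +
    Matrix.diagonal (fun x : Fin M × Fin M => if x.1 = x.2 then (0 : ℂ) else 1) ⊗ₖ B

lemma labelBlocks_apply (A B : Matrix n n ℂ) (k l k' l' : Fin M) (i j : n) :
    labelBlocks M A B ((k, l), i) ((k', l'), j) =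
      if k = k' then if l = l' then if k = l then A i j else B i j else 0 else 0 := by
  by_cases hk : k = k' <;> by_cases hl : l = l' <;> by_cases h : k = l <;>
    simp_all [labelBlocks]

lemma labelBlocks_posSemidef [Fintype n] {A B : Matrix n n ℂ} (hA : A.PosSemidef)
    (hB : B.PosSemidef) : (labelBlocks M A B).PosSemidef := by
  refine Matrix.PosSemidef.add (Matrix.PosSemidef.kronecker (.diagonal fun x => ?_) hA)
    (Matrix.PosSemidef.kronecker (.diagonal fun x => ?_) hB)
  all_goals dsimp only [Pi.zero_apply]; split_ifs <;> simp

lemma sum_label (k : Fin M) (x y : ℂ) :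
    ∑ l, (if k = l then x else y) = x + ((M : ℂ) - 1) * y := by
  have : ∀ l, (if k = l then x else y) = y + if k = l then x - y else 0 := fun l => by
    split_ifs <;> ring
  simp only [this, Finset.sum_add_distrib]
  simp
  ring

lemma sum_label' (k : Fin M) (x y : ℂ) :
    ∑ l, (if l = k then x else y) = x + ((M : ℂ) - 1) * y := by
  rw [← sum_label k]
  simp only [eq_comm]

end Blocks

section Construction

variable {a b : Type*} [Fintype a] [Fintype b] [DecidableEq a] [DecidableEq b] {M : ℕ}

/-- The Choi operator of the code that applies to Bob's input the map with Choi operator `A` and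
outputs the correct estimate, or the map with Choi operator `B` and outputs any given wrong
estimate. -/
def codeChoi (M : ℕ) (A B : Matrix (a × b) (a × b) ℂ) :
    Matrix ((Fin M × b) × (a × Fin M)) ((Fin M × b) × (a × Fin M)) ℂ :=
  (labelBlocks M A B).submatrix (fun x => ((x.1.1, x.2.2), (x.2.1, x.1.2)))
    (fun x => ((x.1.1, x.2.2), (x.2.1, x.1.2)))

lemma sum_mul_ite_eq_trace (X : Matrix (Fin M × b) (Fin M × b) ℂ) (c : ℂ) :
    ∑ u : Fin M × b, ∑ v : Fin M × b,
      X u v * (if u.1 = v.1 then if u.2 = v.2 then c else 0 else 0) = X.trace * c := by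
  have : ∀ u v : Fin M × b, X u v * (if u.1 = v.1 then if u.2 = v.2 then c else 0 else 0) =
      if u = v then X u v * c else 0 := fun u v => by
    by_cases h1 : u.1 = v.1 <;> by_cases h2 : u.2 = v.2 <;> simp [h1, h2, Prod.ext_iff]
  simp [this, Matrix.trace, Finset.sum_mul]

omit [Fintype a] [DecidableEq a] in
lemma traceRight_mapOfChoi_codeChoi {A B : Matrix (a × b) (a × b) ℂ} {ρ : Matrix a a ℂ}
    (h : A + ((M : ℂ) - 1) • B = ρ ⊗ₖ (1 : Matrix b b ℂ))
    (X : Matrix (Fin M × b) (Fin M × b) ℂ) :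
    traceRight (mapOfChoi (codeChoi M A B) X) = X.trace • ρ := by
  ext i j
  have hent : ∀ p q, A (i, p) (j, q) + ((M : ℂ) - 1) * B (i, p) (j, q) =
      if p = q then ρ i j else 0 := fun p q => by
    have := congrFun (congrFun h (i, p)) (j, q)
    simpa [Matrix.one_apply] using this
  rw [Matrix.smul_apply, smul_eq_mul, ← sum_mul_ite_eq_trace]
  simp only [traceRight, Matrix.of_apply, mapOfChoi_apply]
  rw [Finset.sum_comm]
  refine Finset.sum_congr rfl fun u _ => ?_
  rw [Finset.sum_comm]
  refine Finset.sum_congr rfl fun v _ => ?_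
  rw [← Finset.mul_sum]
  congr 1
  by_cases huv : u.1 = v.1
  · simp only [codeChoi, Matrix.submatrix_apply, labelBlocks_apply, huv, if_true, sum_label, hent]
  · simp [codeChoi, labelBlocks_apply, huv]

omit [DecidableEq a] in
lemma traceLeft_mapOfChoi_codeChoi {A B : Matrix (a × b) (a × b) ℂ} {c : ℝ}
    (hA : traceLeft A = c • (1 : Matrix b b ℂ)) (hB : traceLeft B = c • (1 : Matrix b b ℂ))
    (X : Matrix (Fin M × b) (Fin M × b) ℂ) :
    traceLeft (mapOfChoi (codeChoi M A B) X) = (X.trace * c) • (1 : Matrix (Fin M) (Fin M) ℂ) := by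
  have hA' : ∀ p q, ∑ i, A (i, p) (i, q) = if p = q then (c : ℂ) else 0 := fun p q => by
    have := congrFun (congrFun hA p) q
    simpa [traceLeft, Matrix.one_apply] using this
  have hB' : ∀ p q, ∑ i, B (i, p) (i, q) = if p = q then (c : ℂ) else 0 := fun p q => by
    have := congrFun (congrFun hB p) q
    simpa [traceLeft, Matrix.one_apply] using this
  ext l l'
  simp only [traceLeft, Matrix.of_apply, mapOfChoi_apply, Matrix.smul_apply, smul_eq_mul,
    Matrix.one_apply]
  by_cases hl : l = l'
  · subst hl
    rw [if_pos rfl, mul_one, ← sum_mul_ite_eq_trace, Finset.sum_comm]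
    refine Finset.sum_congr rfl fun u _ => ?_
    rw [Finset.sum_comm]
    refine Finset.sum_congr rfl fun v _ => ?_
    rw [← Finset.mul_sum]
    congr 1
    by_cases huv : u.1 = v.1
    · by_cases hul : v.1 = l
      · simp [codeChoi, labelBlocks_apply, huv, hul, hA']
      · simp [codeChoi, labelBlocks_apply, huv, hul, hB']
    · simp [codeChoi, labelBlocks_apply, huv]
  · simp [codeChoi, labelBlocks_apply, hl]

/-- Every pair `0 ≤ F ≤ τ ⊗ 1` with marginal `1 / M` comes from a no-signalling code of size `M`:
given `F`, wrong estimates use `G = (τ ⊗ 1 - F) / (M - 1)`, which has the same marginal as `F`. -/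
lemma exists_isNSCode (hM : 2 ≤ M) {x : Matrix a a ℂ × Matrix (a × b) (a × b) ℂ}
    (hx : x ∈ dominatedPairs a b) (hmarg : traceLeft x.2 = (M : ℝ)⁻¹ • (1 : Matrix b b ℂ))
    (N : Matrix a a ℂ →ₗ[ℂ] Matrix b b ℂ) :
    ∃ P : Matrix (Fin M × b) (Fin M × b) ℂ →ₗ[ℂ] Matrix (a × Fin M) (a × Fin M) ℂ,
      IsNSCode P ∧ successProb P N = (x.2 * choi N).trace.re := by
  obtain ⟨τ, F⟩ := x
  obtain ⟨hτ, hF, hFτ⟩ := hx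
  dsimp only at hτ hF hFτ hmarg ⊢
  have hM2 : (2 : ℝ) ≤ M := by exact_mod_cast hM
  have hM1 : ((M : ℝ) - 1) ≠ 0 := by linarith
  have hMC : ((M : ℂ) - 1) ≠ 0 := by exact_mod_cast hM1
  let A := F.transpose
  let B := ((M : ℝ) - 1)⁻¹ • (τ.transpose ⊗ₖ (1 : Matrix b b ℂ) - A)
  have hA : A.PosSemidef := hF.transpose
  have hB : B.PosSemidef := by
    refine posSemidef_real_smul ?_ (inv_nonneg.mpr (by linarith))
    have := hFτ.transpose
    rwa [Matrix.transpose_sub, ← Matrix.kroneckerMap_transpose, Matrix.transpose_one] at this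
  have hAB : A + ((M : ℂ) - 1) • B = τ.transpose ⊗ₖ (1 : Matrix b b ℂ) := by
    have e : ((M : ℂ) - 1) • B = τ.transpose ⊗ₖ (1 : Matrix b b ℂ) - A := by
      ext u v
      simp only [B, Matrix.smul_apply, smul_eq_mul, Complex.real_smul, Complex.ofReal_inv,
        Complex.ofReal_sub, Complex.ofReal_natCast, Complex.ofReal_one]
      rw [← mul_assoc, mul_inv_cancel₀ hMC, one_mul]
    rw [e, add_sub_cancel]
  have hAm : traceLeft A = (M : ℝ)⁻¹ • (1 : Matrix b b ℂ) := by
    have := congrArg Matrix.transpose hmarg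
    rw [Matrix.transpose_smul, Matrix.transpose_one] at this
    exact this
  have hBm : traceLeft B = (M : ℝ)⁻¹ • (1 : Matrix b b ℂ) := by
    have h2 : traceLeft (τ.transpose ⊗ₖ (1 : Matrix b b ℂ) - A) =
        (1 - (M : ℝ)⁻¹) • (1 : Matrix b b ℂ) := by
      have h3 := traceLeft_add (τ.transpose ⊗ₖ (1 : Matrix b b ℂ) - A) A
      rw [sub_add_cancel, traceLeft_kronecker, hτ.transpose.2, one_smul, hAm] at h3
      rw [sub_smul, one_smul]
      exact eq_sub_of_add_eq h3.symm
    simp only [B, traceLeft_smul, h2, smul_smul]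
    congr 1
    field_simp
  let P := mapOfChoi (codeChoi M A B)
  have hR : ∀ X, traceRight (P X) = X.trace • τ.transpose :=
    traceRight_mapOfChoi_codeChoi hAB
  have hL : ∀ X, traceLeft (P X) = (X.trace * ((M : ℝ)⁻¹ : ℝ)) • 1 :=
    traceLeft_mapOfChoi_codeChoi hAm hBm
  refine ⟨P, ⟨⟨?_, fun X => ?_⟩, fun X Y h => ?_, fun X Y h => ?_⟩, ?_⟩
  · exact isCompletelyPositive_mapOfChoi ((labelBlocks_posSemidef hA hB).submatrix _)
  · rw [← trace_traceRight, hR, Matrix.trace_smul, hτ.transpose.2, smul_eq_mul, mul_one]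
  · rw [hR, hR, ← trace_traceRight X, h, trace_traceRight]
  · rw [hL, hL, ← trace_traceLeft X, h, trace_traceLeft]
  · have e : codeOperator P = A := by
      have h1 : ∀ k, codeBlock P k k = A := fun k => by
        ext u v
        simp [codeBlock, P, choi_mapOfChoi, codeChoi, labelBlocks_apply]
      simp only [codeOperator, h1, Finset.sum_const, Finset.card_univ, Fintype.card_fin]
      rw [← Nat.cast_smul_eq_nsmul ℝ, smul_smul, inv_mul_cancel₀ (by linarith), one_smul]
    rw [successProb_eq, e]
    rfl

end Construction

/-! ### The channel with a classical side channel -/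

section Activation

variable {a b : Type*} [Fintype a] [Fintype b] [DecidableEq a] [DecidableEq b] {m : ℕ}

lemma classicalId_apply (X : Matrix (Fin m) (Fin m) ℂ) (y y' : Fin m) :
    classicalId m X y y' = if y = y' then X y y else 0 := by
  have h : classicalId m X = ∑ i, X i i • Matrix.single i i (1 : ℂ) := by
    change ∑ i, (X * Matrix.single i i 1).trace • Matrix.single i i (1 : ℂ) = _
    refine Finset.sum_congr rfl fun i _ => ?_
    rw [Matrix.trace_mul_comm, Matrix.trace_single_mul, one_smul]
  rw [h]
  by_cases hy : y = y' <;> simp [Matrix.sum_apply, Matrix.single_apply, hy, ite_and]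

omit [Fintype a] [Fintype b] [DecidableEq b] in
lemma choi_tensorMap_classicalId (N : Matrix a a ℂ →ₗ[ℂ] Matrix b b ℂ) (i j : a) (p q : b)
    (x x' y y' : Fin m) :
    choi (tensorMap N (classicalId m)) ((i, x), (p, y)) ((j, x'), (q, y')) =
      if x = x' then if y = y' then if x = y then choi N (i, p) (j, q) else 0 else 0 else 0 := by
  have h1 : (Matrix.of fun u v : a => (Matrix.single (i, x) (j, x') (1 : ℂ) :
      Matrix (a × Fin m) (a × Fin m) ℂ) (u, y) (v, y)) =
      if x = y then if x' = y then Matrix.single i j 1 else 0 else 0 := by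
    ext u v
    by_cases hx : x = y <;> by_cases hx' : x' = y <;> simp [Matrix.single_apply, hx, hx']
  rw [choi_apply]
  change classicalId m (Matrix.of fun z z' => N (Matrix.of fun u v : a =>
    (Matrix.single (i, x) (j, x') (1 : ℂ) : Matrix (a × Fin m) (a × Fin m) ℂ) (u, z) (v, z'))
      p q) y y' = _
  rw [classicalId_apply]
  simp only [Matrix.of_apply, h1]
  by_cases hx : x = y
  · subst hx
    by_cases hx' : x' = x
    · subst hx'
      simp [choi_apply]
    · simp [hx', Ne.symm hx']
  · simp [hx]

/-- The block of an operator on the channel with a classical side channel in which the classical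
input is `x` and the classical output is `y`. -/
def classicalBlock (F : Matrix ((a × Fin m) × (b × Fin m)) ((a × Fin m) × (b × Fin m)) ℂ)
    (x y : Fin m) : Matrix (a × b) (a × b) ℂ :=
  F.submatrix (fun z => ((z.1, x), (z.2, y))) (fun z => ((z.1, x), (z.2, y)))

omit [DecidableEq b] in
/-- Only the blocks in which the classical symbol is transmitted faithfully contribute. -/
lemma trace_mul_choi_tensorMap (N : Matrix a a ℂ →ₗ[ℂ] Matrix b b ℂ)
    (F : Matrix ((a × Fin m) × (b × Fin m)) ((a × Fin m) × (b × Fin m)) ℂ) :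
    (F * choi (tensorMap N (classicalId m))).trace =
      ((∑ x, classicalBlock F x x) * choi N).trace := by
  rw [Matrix.sum_mul, Matrix.trace_sum]
  simp only [Matrix.trace, Matrix.diag_apply, Matrix.mul_apply, Fintype.sum_prod_type,
    choi_tensorMap_classicalId, mul_ite, mul_zero, classicalBlock, Matrix.submatrix_apply]
  rw [Finset.sum_comm]
  refine Finset.sum_congr rfl fun x _ => Finset.sum_congr rfl fun i _ =>
    Finset.sum_congr rfl fun p _ => ?_
  have h : ∀ (f : a → Fin m → b → Fin m → Fin m → ℂ),
      (∑ y : Fin m, ∑ j : a, ∑ x' : Fin m, ∑ q : b, ∑ y' : Fin m,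
        if x' = x then if y' = y then if x' = y' then f j x' q y' y else 0 else 0 else 0) =
      ∑ j : a, ∑ q : b, f j x q x x := by
    intro f
    rw [Finset.sum_comm]
    refine Finset.sum_congr rfl fun j _ => ?_
    rw [Finset.sum_eq_single x]
    · rw [Finset.sum_eq_single x]
      · simp
      · intro x' _ hx'; simp [hx']
      · simp
    · intro y _ hy
      refine Finset.sum_eq_zero fun x' _ => Finset.sum_eq_zero fun q _ =>
        Finset.sum_eq_zero fun y' _ => ?_
      split_ifs with h1 h2 h3
      · exact absurd (h2.symm.trans (h3.symm.trans h1)) hy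
      all_goals rfl
    · simp
  exact h fun j x' q y' y => F ((i, x), (p, y)) ((j, x'), (q, y')) * choi N (j, q) (i, p)

/-! ### Converse -/

/-- Summing the blocks with faithful classical symbol turns a dominated pair for
`N ⊗ I_m` with marginal `1 / M` into one for `N` with marginal at most `m / M`. -/
lemma exists_dominatedPair_of_tensor
    {x : Matrix (a × Fin m) (a × Fin m) ℂ ×
      Matrix ((a × Fin m) × (b × Fin m)) ((a × Fin m) × (b × Fin m)) ℂ}
    (hx : x ∈ dominatedPairs (a × Fin m) (b × Fin m)) {c : ℝ}
    (hmarg : traceLeft x.2 = c • (1 : Matrix (b × Fin m) (b × Fin m) ℂ))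
    (N : Matrix a a ℂ →ₗ[ℂ] Matrix b b ℂ) :
    ∃ z ∈ dominatedPairs a b, (((m : ℝ) * c) • (1 : Matrix b b ℂ) - traceLeft z.2).PosSemidef ∧
      (x.2 * choi (tensorMap N (classicalId m))).trace = (z.2 * choi N).trace := by
  obtain ⟨τ, F⟩ := x
  obtain ⟨hτ, hF, hFτ⟩ := hx
  dsimp only at hτ hF hFτ hmarg ⊢
  refine ⟨(traceRight τ, ∑ x, classicalBlock F x x), ⟨⟨?_, ?_⟩, ?_, ?_⟩, ?_,
    trace_mul_choi_tensorMap N F⟩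
  · have e : traceRight τ = ∑ x, τ.submatrix (fun i => (i, x)) (fun i => (i, x)) := by
      ext i j; simp [traceRight, Matrix.sum_apply]
    dsimp only
    rw [e]
    exact Matrix.posSemidef_sum _ fun x _ => hτ.1.submatrix _
  · rw [trace_traceRight, hτ.2]
  · exact Matrix.posSemidef_sum _ fun x _ => hF.submatrix _
  · have e : traceRight τ ⊗ₖ (1 : Matrix b b ℂ) - ∑ x, classicalBlock F x x =
        ∑ x, (τ ⊗ₖ (1 : Matrix (b × Fin m) (b × Fin m) ℂ) - F).submatrix
          (fun z : a × b => ((z.1, x), (z.2, x))) (fun z : a × b => ((z.1, x), (z.2, x))) := by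
      ext ⟨i, p⟩ ⟨j, q⟩
      simp [traceRight, Matrix.sum_apply, classicalBlock, Matrix.one_apply]
    dsimp only
    rw [e]
    exact Matrix.posSemidef_sum _ fun x _ => hFτ.submatrix _
  · have e : ((m : ℝ) * c) • (1 : Matrix b b ℂ) - traceLeft (∑ x, classicalBlock F x x) =
        ∑ y, ∑ x ∈ Finset.univ.erase y, ∑ i,
          F.submatrix (fun p : b => ((i, x), (p, y))) (fun p : b => ((i, x), (p, y))) := by
      ext p q
      have h1 : ∀ y, ∑ x, ∑ i, F ((i, x), (p, y)) ((i, x), (q, y)) =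
          if p = q then (c : ℂ) else 0 := fun y => by
        have := congrFun (congrFun hmarg (p, y)) (q, y)
        rw [Finset.sum_comm, ← Fintype.sum_prod_type
          (f := fun z : a × Fin m => F (z, (p, y)) (z, (q, y)))]
        simpa [traceLeft, Matrix.one_apply] using this
      simp only [Matrix.sub_apply, Matrix.smul_apply, Matrix.sum_apply, Matrix.submatrix_apply,
        Finset.sum_erase_eq_sub (Finset.mem_univ _), h1, traceLeft, Matrix.of_apply,
        classicalBlock, Finset.sum_sub_distrib, Matrix.one_apply]
      rw [Finset.sum_comm (γ := a)]
      congr 1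
      by_cases hpq : p = q <;> simp [hpq]
    dsimp only
    rw [e]
    exact Matrix.posSemidef_sum _ fun y _ => Matrix.posSemidef_sum _ fun x _ =>
      Matrix.posSemidef_sum _ fun i _ => hF.submatrix _

lemma bddAbove_successProb {a b : Type*} [Fintype a] [Fintype b] [DecidableEq a] [DecidableEq b]
    [Nonempty b] {M : ℕ} (hM : 1 ≤ M) (N : Matrix a a ℂ →ₗ[ℂ] Matrix b b ℂ) :
    BddAbove {s : ℝ | ∃ P : Matrix (Fin M × b) (Fin M × b) ℂ →ₗ[ℂ]
      Matrix (a × Fin M) (a × Fin M) ℂ, IsNSCode P ∧ s = successProb P N} := by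
  refine (((isCompact_dominatedPairs (a := a) (b := b)).image (f := fun x =>
    (x.2 * choi N).trace.re) (by fun_prop)).bddAbove).mono ?_
  rintro _ ⟨P, hP, rfl⟩
  obtain ⟨x, hx, -, h⟩ := hP.exists_dominatedPair hM N
  exact ⟨x, hx, h.symm⟩

/-- Coding `M` messages through `N ⊗ I_m` makes the overlap `m / M` achievable. The optimal
success probability is a supremum over codes, but the dominated pairs form a compact set. -/
lemma isAchievableOverlap_of_le_optSuccessNS [Nonempty b] {ε : ℝ} (hε : ε < 1)
    (N : Matrix a a ℂ →ₗ[ℂ] Matrix b b ℂ) (hm : 1 ≤ m) {M : ℕ} (hM : 1 ≤ M)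
    (h : 1 - ε ≤ optSuccessNS (tensorMap N (classicalId m)) M) :
    IsAchievableOverlap N ε ((m : ℝ) / M) := by
  have : Nonempty (Fin m) := ⟨⟨0, hm⟩⟩
  let D := dominatedPairs a b ∩
    {x | (((m : ℝ) / M) • (1 : Matrix b b ℂ) - traceLeft x.2).PosSemidef}
  have hD : IsCompact D :=
    isCompact_dominatedPairs.inter_right (isClosed_posSemidef.preimage (by fun_prop))
  have hcode : ∀ s ∈ {s : ℝ | ∃ P : Matrix (Fin M × (b × Fin m)) (Fin M × (b × Fin m)) ℂ →ₗ[ℂ]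
      Matrix ((a × Fin m) × Fin M) ((a × Fin m) × Fin M) ℂ,
      IsNSCode P ∧ s = successProb P (tensorMap N (classicalId m))},
      ∃ z ∈ D, s = (z.2 * choi N).trace.re := by
    rintro _ ⟨P, hP, rfl⟩
    obtain ⟨x, hx, hmarg, hs⟩ := hP.exists_dominatedPair hM (tensorMap N (classicalId m))
    obtain ⟨z, hz, hzm, htr⟩ := exists_dominatedPair_of_tensor hx hmarg N
    exact ⟨z, ⟨hz, by rwa [← div_eq_mul_inv] at hzm⟩, by rw [hs, htr]⟩
  have hne : D.Nonempty := by
    by_contra hD0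
    have h0 : optSuccessNS (tensorMap N (classicalId m)) M ≤ 0 :=
      Real.sSup_nonpos fun s hs => by
        obtain ⟨z, hz, -⟩ := hcode s hs
        exact absurd ⟨z, hz⟩ hD0
    linarith
  obtain ⟨z, hz, hmax⟩ := hD.exists_isMaxOn hne
    (f := fun x => (x.2 * choi N).trace.re) (by fun_prop)
  have hle : 1 - ε ≤ (z.2 * choi N).trace.re := by
    refine h.trans (Real.sSup_le ?_ ?_)
    · intro s hs
      obtain ⟨w, hw, rfl⟩ := hcode s hs
      exact hmax hw
    · by_contra! hneg
      have : optSuccessNS (tensorMap N (classicalId m)) M ≤ 0 :=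
        Real.sSup_nonpos fun s hs => by
          obtain ⟨w, hw, rfl⟩ := hcode s hs
          exact (hmax hw).trans hneg.le
      linarith
  exact ⟨z.1, hz.1.1, z.2, ⟨hz.1.2, by linarith⟩, hz.2⟩

/-! ### Achievability -/

/-- With a classical side channel the marginal inequality can be made an equality: on unfaithful
pairs of classical symbols, the operator `τ ⊗ Y` fills the marginal up. -/
lemma exists_tensor_dominatedPair {M : ℕ} (hm : 2 ≤ m) (hM : 2 ≤ M)
    {z : Matrix a a ℂ × Matrix (a × b) (a × b) ℂ} (hz : z ∈ dominatedPairs a b)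
    (hmarg : (((m : ℝ) / M) • (1 : Matrix b b ℂ) - traceLeft z.2).PosSemidef)
    (N : Matrix a a ℂ →ₗ[ℂ] Matrix b b ℂ) :
    ∃ x ∈ dominatedPairs (a × Fin m) (b × Fin m),
      traceLeft x.2 = (M : ℝ)⁻¹ • (1 : Matrix (b × Fin m) (b × Fin m) ℂ) ∧
      (x.2 * choi (tensorMap N (classicalId m))).trace = (z.2 * choi N).trace := by
  obtain ⟨τ, F⟩ := z
  obtain ⟨hτ, hF, hFτ⟩ := hz
  dsimp only at hτ hF hFτ hmarg ⊢
  have hm2 : (2 : ℝ) ≤ m := by exact_mod_cast hm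
  have hM2 : (2 : ℝ) ≤ M := by exact_mod_cast hM
  have hm0 : (m : ℝ) ≠ 0 := by linarith
  have hm1 : (m : ℝ) - 1 ≠ 0 := by linarith
  let r : ℝ := ((m : ℝ) * (m - 1))⁻¹
  have hr : 0 ≤ r := inv_nonneg.mpr (mul_nonneg (by linarith) (by linarith))
  let Y : Matrix b b ℂ := r • (((m : ℝ) / M) • (1 : Matrix b b ℂ) - traceLeft F)
  have hY : Y.PosSemidef := posSemidef_real_smul hmarg hr
  have hFB : (traceLeft F).PosSemidef := by
    have e : traceLeft F = ∑ i, F.submatrix (fun p => (i, p)) (fun p => (i, p)) := by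
      ext; simp [traceLeft, Matrix.sum_apply]
    rw [e]
    exact Matrix.posSemidef_sum _ fun i _ => hF.submatrix _
  -- This is where `2 ≤ m` and `2 ≤ M` enter: they give `m / M ≤ m - 1`.
  have hY1 : ((m : ℝ)⁻¹ • (1 : Matrix b b ℂ) - Y).PosSemidef := by
    have e : (m : ℝ)⁻¹ • (1 : Matrix b b ℂ) - Y =
        r • ((((m : ℝ) - 1) - m / M) • (1 : Matrix b b ℂ) + traceLeft F) := by
      have : (m : ℝ)⁻¹ = r * (m - 1) := by simp only [r]; field_simp
      simp only [Y]
      rw [this]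
      module
    rw [e]
    refine posSemidef_real_smul ((posSemidef_real_smul Matrix.PosSemidef.one ?_).add hFB) hr
    have : (m : ℝ) / M ≤ m / 2 := div_le_div_of_nonneg_left (by linarith) (by norm_num) hM2
    linarith
  let f : (a × Fin m) × (b × Fin m) → (Fin m × Fin m) × (a × b) :=
    fun x => ((x.1.2, x.2.2), (x.1.1, x.2.1))
  let A : Matrix (a × b) (a × b) ℂ := (m : ℝ)⁻¹ • F
  let B : Matrix (a × b) (a × b) ℂ := τ ⊗ₖ Y
  let Ft := (labelBlocks m A B).submatrix f f
  let τt : Matrix (a × Fin m) (a × Fin m) ℂ :=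
    τ ⊗ₖ ((m : ℝ)⁻¹ • (1 : Matrix (Fin m) (Fin m) ℂ))
  have hminv : (0 : ℝ) ≤ (m : ℝ)⁻¹ := by positivity
  refine ⟨(τt, Ft), ⟨⟨?_, ?_⟩, ?_, ?_⟩, ?_, ?_⟩
  · exact hτ.1.kronecker (posSemidef_real_smul Matrix.PosSemidef.one hminv)
  · dsimp only [τt]
    rw [Matrix.trace_kronecker, hτ.2, one_mul, Matrix.trace_smul, Matrix.trace_one,
      Fintype.card_fin, Complex.real_smul, Complex.ofReal_inv, Complex.ofReal_natCast]
    exact inv_mul_cancel₀ (by exact_mod_cast hm0)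
  · exact (labelBlocks_posSemidef (posSemidef_real_smul hF hminv)
      (hτ.1.kronecker hY)).submatrix _
  · have e : τt ⊗ₖ (1 : Matrix (b × Fin m) (b × Fin m) ℂ) - Ft =
        (labelBlocks m ((m : ℝ)⁻¹ • (τ ⊗ₖ (1 : Matrix b b ℂ) - F))
          (τ ⊗ₖ ((m : ℝ)⁻¹ • (1 : Matrix b b ℂ) - Y))).submatrix f f := by
      ext ⟨⟨i, x⟩, ⟨p, y⟩⟩ ⟨⟨j, x'⟩, ⟨q, y'⟩⟩
      simp only [Matrix.sub_apply, Matrix.submatrix_apply, Ft, f, labelBlocks_apply, τt,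
        Matrix.kroneckerMap_apply, Matrix.smul_apply, Matrix.one_apply, Prod.mk.injEq, A, B,
        Complex.real_smul]
      by_cases hx : x = x'
      · subst hx
        by_cases hy : y = y'
        · subst hy
          by_cases hxy : x = y <;> by_cases hpq : p = q <;> simp [hxy, hpq] <;> ring
        · simp [hy]
      · simp [hx]
    dsimp only
    rw [e]
    exact (labelBlocks_posSemidef (posSemidef_real_smul hFτ hminv)
      (hτ.1.kronecker hY1)).submatrix _
  · have hB : ∀ p q, ∑ i, B (i, p) (i, q) = Y p q := fun p q => by
      have := congrFun (congrFun (traceLeft_kronecker τ Y) p) q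
      rw [hτ.2, one_smul] at this
      exact this
    have hA : ∀ p q, ∑ i, A (i, p) (i, q) = (m : ℂ)⁻¹ * traceLeft F p q := fun p q => by
      simp [A, traceLeft, Finset.mul_sum]
    ext ⟨p, y⟩ ⟨q, y'⟩
    simp only [traceLeft, Matrix.of_apply, Ft, Matrix.submatrix_apply, f, Fintype.sum_prod_type,
      labelBlocks_apply, if_true, Matrix.smul_apply, Matrix.one_apply, Prod.mk.injEq]
    by_cases hy : y = y'
    · subst hy
      simp only [if_true, sum_label', Finset.sum_add_distrib, ← Finset.mul_sum, hA, hB, and_true]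
      simp only [Y, Matrix.smul_apply, Matrix.sub_apply, Matrix.one_apply, Complex.real_smul, r]
      have hmC : (m : ℂ) ≠ 0 := by exact_mod_cast hm0
      have hmC1 : (m : ℂ) - 1 ≠ 0 := by exact_mod_cast hm1
      have hMC : (M : ℂ) ≠ 0 := by exact_mod_cast (by omega : M ≠ 0)
      push_cast
      split_ifs <;> field_simp <;> ring
    · simp [hy]
  · rw [trace_mul_choi_tensorMap]
    have e : ∑ x, classicalBlock Ft x x = F := by
      have h1 : ∀ x, classicalBlock Ft x x = A := fun x => by
        ext u v
        simp [classicalBlock, Ft, f, labelBlocks_apply]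
      simp only [h1, Finset.sum_const, Finset.card_univ, Fintype.card_fin, A]
      rw [← Nat.cast_smul_eq_nsmul ℝ, smul_smul, mul_inv_cancel₀ hm0, one_smul]
    rw [e]

lemma le_optSuccessNS_of_isAchievableOverlap [Nonempty b] {N : Matrix a a ℂ →ₗ[ℂ] Matrix b b ℂ}
    {ε η : ℝ} (h : IsAchievableOverlap N ε η) {M : ℕ} (hm : 2 ≤ m) (hM : 2 ≤ M)
    (hη : η ≤ (m : ℝ) / M) : 1 - ε ≤ optSuccessNS (tensorMap N (classicalId m)) M := by
  obtain ⟨τ, hτ, F, ⟨hF, hFε⟩, hFη⟩ := h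
  have : Nonempty (Fin m) := ⟨⟨0, by omega⟩⟩
  have hmarg : (((m : ℝ) / M) • (1 : Matrix b b ℂ) - traceLeft F).PosSemidef := by
    have e : ((m : ℝ) / M) • (1 : Matrix b b ℂ) - traceLeft F =
        ((m : ℝ) / M - η) • (1 : Matrix b b ℂ) + (η • (1 : Matrix b b ℂ) - traceLeft F) := by
      module
    rw [e]
    exact (posSemidef_real_smul Matrix.PosSemidef.one (sub_nonneg.mpr hη)).add hFη
  obtain ⟨x, hx, hxm, hxt⟩ := exists_tensor_dominatedPair hm hM (z := (τ, F)) ⟨hτ, hF⟩ hmarg N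
  obtain ⟨P, hP, hPs⟩ := exists_isNSCode hM hx hxm (tensorMap N (classicalId m))
  refine le_trans ?_ (le_csSup (bddAbove_successProb (by omega) _) ⟨P, hP, rfl⟩)
  rw [hPs, hxt]
  dsimp only
  linarith

/-! ### The activated capacity -/

/-- The activated capacity is `-log₂` of the least achievable overlap `η`: the ratios `m / M` that
occur in codes are at least `η`, and `⌈η n⌉ / n → η`. -/
lemma activatedCapacityNS_eq [Nonempty b] {N : Matrix a a ℂ →ₗ[ℂ] Matrix b b ℂ} {ε : ℝ}
    (hε : ε < 1) {η : ℝ} (hη : IsLeast {η | IsAchievableOverlap N ε η} η) :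
    activatedCapacityNS N ε = ((-Real.logb 2 η : ℝ) : EReal) := by
  have hpos := hη.1.pos hε
  apply le_antisymm
  · refine iSup₂_le fun m hm => ?_
    have hm0 : (0 : ℝ) < m := by exact_mod_cast hm
    rw [EReal.sub_le_iff_le_add (Or.inl (EReal.coe_ne_bot _)) (Or.inl (EReal.coe_ne_top _)),
      ← EReal.coe_add]
    refine iSup_le fun M => iSup₂_le fun hM hs => ?_
    have hM0 : (0 : ℝ) < M := by exact_mod_cast hM
    rw [EReal.coe_le_coe_iff]
    have h1 := Real.logb_le_logb_of_le one_lt_two hpos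
      (hη.2 (isAchievableOverlap_of_le_optSuccessNS hε N hm hM hs))
    rw [Real.logb_div hm0.ne' hM0.ne'] at h1
    linarith
  · have hbound : ∀ m M : ℕ, 2 ≤ m → 2 ≤ M → η ≤ (m : ℝ) / M →
        ((-Real.logb 2 ((m : ℝ) / M) : ℝ) : EReal) ≤ activatedCapacityNS N ε := by
      intro m M hm hM hle
      have hm0 : (m : ℝ) ≠ 0 := by exact_mod_cast (by omega : m ≠ 0)
      have hM0 : (M : ℝ) ≠ 0 := by exact_mod_cast (by omega : M ≠ 0)
      have hs := le_optSuccessNS_of_isAchievableOverlap hη.1 hm hM hle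
      have h1 : ((Real.logb 2 M : ℝ) : EReal) ≤ capacityNS (tensorMap N (classicalId m)) ε :=
        le_iSup_of_le M (le_iSup₂_of_le (by omega) hs le_rfl)
      refine le_trans ?_ (le_iSup₂_of_le m (by omega : 1 ≤ m) (EReal.sub_le_sub h1 le_rfl))
      rw [← EReal.coe_sub, EReal.coe_le_coe_iff, Real.logb_div hm0 hM0]
      linarith
    have hlim : Filter.Tendsto (fun n : ℕ => ((⌈η * n⌉₊ : ℕ) : ℝ) / n) Filter.atTop (nhds η) :=
      (tendsto_nat_ceil_mul_div_atTop hpos.le).comp tendsto_natCast_atTop_atTop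
    have hlim2 : Filter.Tendsto
        (fun n : ℕ => ((-Real.logb 2 (((⌈η * n⌉₊ : ℕ) : ℝ) / n) : ℝ) : EReal)) Filter.atTop
        (nhds ((-Real.logb 2 η : ℝ) : EReal)) :=
      (continuous_coe_real_ereal.tendsto _).comp
        ((((Real.continuousAt_logb hpos.ne').tendsto).comp hlim).neg)
    refine le_of_tendsto hlim2 ?_
    -- For these `n` the numerator `⌈η n⌉` is at least `2`.
    have hlarge : ∀ᶠ n : ℕ in Filter.atTop, 1 < η * n :=
      (tendsto_natCast_atTop_atTop.const_mul_atTop hpos).eventually_gt_atTop 1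
    filter_upwards [hlarge, Filter.eventually_ge_atTop 2] with n hn hn2
    have hn0 : (0 : ℝ) < n := by exact_mod_cast (by omega : 0 < n)
    refine hbound _ n ?_ hn2 ?_
    · exact Nat.lt_ceil.mpr (by exact_mod_cast hn)
    · rw [le_div_iff₀ hn0]
      exact Nat.le_ceil _

omit [DecidableEq b] in
lemma IsChannel.nonempty_output [Nonempty a] {N : Matrix a a ℂ →ₗ[ℂ] Matrix b b ℂ}
    (hN : IsChannel N) : Nonempty b := by
  by_contra hb
  rw [not_nonempty_iff] at hb
  obtain ⟨ρ, hρ⟩ := exists_isState (n := a)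
  have := hN.trace_preserving ρ
  rw [hρ.2] at this
  simp [Matrix.trace] at this

end Activation

end QuantumChannelCoding

end

/-- The one-shot activated no-signalling-assisted capacity equals the Matthews–Wehner
meta-converse; the maximum and the minimum that define the latter are attained. -/
theorem theorem1 {a b : Type*} [Fintype a] [DecidableEq a] [Nonempty a]
    [Fintype b] [DecidableEq b]
    (N : Matrix a a ℂ →ₗ[ℂ] Matrix b b ℂ) (hN : QuantumChannelCoding.IsChannel N)
    (ε : ℝ) (hε : ε ∈ Set.Ioo (0 : ℝ) 1) :
    QuantumChannelCoding.activatedCapacityNS N ε = QuantumChannelCoding.metaConverse N ε ∧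
    (∃ ρ : Matrix a a ℂ, QuantumChannelCoding.IsState ρ ∧
      QuantumChannelCoding.metaInner N ε ρ = QuantumChannelCoding.metaConverse N ε) ∧
    (∀ ρ : Matrix a a ℂ, QuantumChannelCoding.IsState ρ →
      ∃ σ : Matrix b b ℂ, QuantumChannelCoding.IsState σ ∧
        QuantumChannelCoding.metaObjective N ε ρ σ = QuantumChannelCoding.metaInner N ε ρ) := by
  have hb : Nonempty b := hN.nonempty_output
  obtain ⟨η, hη⟩ := QuantumChannelCoding.exists_least_isAchievableOverlap hN hε
  obtain ⟨hmeta, hmax⟩ := QuantumChannelCoding.exists_metaInner_eq_metaConverse hN hε hη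
  refine ⟨?_, hmax, fun ρ hρ => ?_⟩
  · rw [QuantumChannelCoding.activatedCapacityNS_eq hε.2 hη, hmeta]
  · obtain ⟨-, -, -, hσ, -⟩ := QuantumChannelCoding.exists_metaInner_eq hN hε hρ
    exact hσ
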